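/- Let $(\Omega,\mathcal F)$ be a measurable space, let $\phi:\mathbb R\to\mathbb R\cup\{+\infty\}$ be convex and lower semicontinuous with $\phi(1)=0$, and put $\phi'(\pm\infty)=\lim_{x\to\pm\infty}\phi(x)/x\in\overline{\mathbb R}$ and $\phi^*(y)=\sup_{x\in\mathbb R}\{xy-\phi(x)\}$. For a finite signed measure $\mu$ and a finite nonnegative measure $\nu$ on $\Omega$, write $\mu=\mu_c+\mu_s$ for the Lebesgue decomposition of $\mu$ with respect to $\nu$ ($\mu_c\ll\nu$, $\mu_s\perp\nu$) and $\mu_s=\mu_s^+-\mu_s^-$ for the Jordan decomposition, and define $$D_\phi(\mu\|\nu)=\int\phi\Big(\frac{d\mu_c}{d\nu}\Big)\,d\nu+\mu_s^+(\Omega)\,\phi'(\infty)-\mu_s^-(\Omega)\,\phi'(-\infty),\qquad 0\cdot(\pm\infty)=0.$$ Let $X$ be a vector space of finite signed measures on $\Omega$ and let $\Xi=\{A\in\mathcal F:\ |\mu|(A)=0\ \text{for all }\mu\in X\}$ be its null $\sigma$-ideal. Let $L^0(\Xi)$ be the space of real measurable functions modulo equality outside an element of $\Xi$. For a measurable $h:\Omega\to\mathbb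 R$, its $\Xi$-essential range is $\operatorname{im}_\Xi h=\bigcap_{\varepsilon>0}\{x\in\mathbb R:\ h^{-1}((x-\varepsilon,x+\varepsilon))\notin\Xi\}$, and $L^\infty(\Xi)$ is the set of classes of functions with bounded $\Xi$-essential range. Let $Y$ be a vector subspace of $L^0(\Xi)$ and let $\nu\in X$ be a finite nonnegative measure such that $(X,Y)$ is $\nu$-decomposable, that is: 1. every $h\in Y$ is $|\mu|$-integrable for every $\mu\in X$, and the pairing $(\mu,h)\mapsto\int h\,d\mu$ puts $X$ and $Y$ in separating duality; 2. $X$ contains every finite signed measure $\mu\ll\nu$ with $\frac{d\mu}{d\nu}\in L^\infty(\nu)$, and $L^\infty(\Xi)\subseteq Y$; 3. for every $A\in\mathcal F\setminus\Xi$ there is a nonzero nonnegative $\mu\in X$ with $\mu(\Omega\setminus A)=0$. ($X$ may contain measures that are not absolutely continuous with respect to $\nu$.) Then: (a) The convex conjugate of the functional $D:\mu\mapsto D_\phi(\mu\|\nu)$ on $X$ is given, for all $h\in Y$, by $$D^*(h)=\sup_{\mu\in X}\Big\{\int h\,d\mu-D_\phi(\mu\|\nu)\Big\}=\begin{cases}\displaystyle\int\phi^*\circ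 h\,d\nu&\text{if }\operatorname{im}_\Xi h\subseteq[\phi'(-\infty),\phi'(\infty)],\\[2pt]+\infty&\text{otherwise.}\end{cases}$$ (b) $D$ is lower semicontinuous on $X$ for the weak topology $\sigma(X,Y)$, and more generally for every topology compatible with the pairing (every locally convex vector space topology on $X$ whose continuous linear forms are exactly the maps $\mu\mapsto\int h\,d\mu$, $h\in Y$). (c) For all $\mu\in X$, $D_\phi(\mu\|\nu)=D^{**}(\mu)=\sup_{h\in Y}\{\int h\,d\mu-D^*(h)\}$, and $$D_\phi(\mu\|\nu)=\sup\Big\{\int g\,d\mu-\int\phi^*\circ g\,d\nu\ :\ g\in Y,\ \operatorname{im}_\Xi g\subseteq[\phi'(-\infty),\phi'(\infty)]\Big\}.$$ -/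

import Mathlib

open MeasureTheory Set Filter Topology

open scoped ENNReal

noncomputable section

namespace PhiDiv

/-! ### Extended-real convex analysis -/

/-- The standing assumptions on the function `φ : ℝ → ℝ ∪ {+∞}`: it never takes the value `-∞`,
it is convex, lower semicontinuous, and `φ 1 = 0`. -/
structure IsDivergenceFunction (φ : ℝ → EReal) : Prop where
  ne_bot : ∀ x, φ x ≠ ⊥
  convex : ∀ x y a b : ℝ, 0 ≤ a → 0 ≤ b → a + b = 1 →
    φ (a * x + b * y) ≤ (a : EReal) * φ x + (b : EReal) * φ y
  lsc : LowerSemicontinuous φ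
  map_one : φ 1 = 0

/-- `φ'(∞) = lim_{x → +∞} φ(x) / x`. -/
def slopeTop (φ : ℝ → EReal) : EReal :=
  limUnder atTop (fun x : ℝ => φ x / (x : EReal))

/-- `φ'(-∞) = lim_{x → -∞} φ(x) / x`. -/
def slopeBot (φ : ℝ → EReal) : EReal :=
  limUnder atBot (fun x : ℝ => φ x / (x : EReal))

/-- The convex conjugate `f*(b) = sup_a (⟨a, b⟩ - f(a))` for a pairing of `A` and `B`. -/
def conjugate {A B : Type*} (pair : A → B → ℝ) (f : A → EReal) (b : B) : EReal :=
  ⨆ a : A, (pair a b : EReal) - f a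

/-- The conjugate `φ*` of a function on the real line. -/
def realConjugate (φ : ℝ → EReal) : ℝ → EReal :=
  conjugate (fun x y : ℝ => x * y) φ

/-- The integral of an extended-real function, as the integral of its positive part minus
the integral of its negative part (meaningful as soon as one of the two is finite). -/
def extIntegral {Ω : Type*} [MeasurableSpace Ω] (ν : Measure Ω) (F : Ω → EReal) : EReal :=
  ((∫⁻ ω, (F ω).toENNReal ∂ν : ℝ≥0∞) : EReal) - ((∫⁻ ω, (-F ω).toENNReal ∂ν : ℝ≥0∞) : EReal)

variable {Ω : Type*} [MeasurableSpace Ω]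

/-! ### The divergence -/

/-- The `φ`-divergence of a finite signed measure `μ` with respect to a nonnegative measure `ν`:
`∫ φ(dμ_c/dν) dν + μ_s⁺(Ω) φ'(∞) - μ_s⁻(Ω) φ'(-∞)`, where `μ = μ_c + μ_s` is the Lebesgue
decomposition of `μ` with respect to `ν` and `μ_s = μ_s⁺ - μ_s⁻` the Jordan decomposition.
In `EReal`, `0 * (±∞) = 0`. -/
def divergence (φ : ℝ → EReal) (ν : Measure Ω) (μ : SignedMeasure Ω) : EReal :=
  extIntegral ν (fun ω => φ (μ.rnDeriv ν ω))
    + ((μ.singularPart ν).toJordanDecomposition.posPart univ : EReal) * slopeTop φ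
    - ((μ.singularPart ν).toJordanDecomposition.negPart univ : EReal) * slopeBot φ

/-! ### Null ideal, essential range, and the space of measurable functions modulo the ideal -/

/-- The null `σ`-ideal `Ξ` of a space `X` of signed measures: the measurable sets that are null
for the total variation of all measures in `X`. -/
def nullIdeal (X : Submodule ℝ (SignedMeasure Ω)) : Set (Set Ω) :=
  {A | MeasurableSet A ∧ ∀ μ ∈ X, μ.variation A = 0}

/-- The essential range of `f` with respect to a `σ`-ideal `Ξ`. -/
def essRange (Ξ : Set (Set Ω)) (f : Ω → ℝ) : Set ℝ :=
  {x | ∀ ε > 0, f ⁻¹' Ioo (x - ε) (x + ε) ∉ Ξ}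

/-- The condition that the `Ξ`-essential range of `f` lies in `[φ'(-∞), φ'(∞)]`. -/
def EssRangeInSlopes (φ : ℝ → EReal) (Ξ : Set (Set Ω)) (f : Ω → ℝ) : Prop :=
  ∀ x ∈ essRange Ξ f, (x : EReal) ∈ Icc (slopeBot φ) (slopeTop φ)

variable (Ω) in
/-- The vector space of real-valued measurable functions on `Ω`. -/
def MeasFun : Submodule ℝ (Ω → ℝ) where
  carrier := {f | Measurable f}
  zero_mem' := measurable_const
  add_mem' hf hg := Measurable.add hf hg
  smul_mem' c _ hf := Measurable.const_smul hf c

theorem measurable_measFun (f : MeasFun Ω) : Measurable (f : Ω → ℝ) := f.2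

/-- The measurable functions that vanish outside an element of the null ideal of `X`. -/
def NullFun (X : Submodule ℝ (SignedMeasure Ω)) : Submodule ℝ (MeasFun Ω) where
  carrier := {f | {ω | (f : Ω → ℝ) ω ≠ 0} ∈ nullIdeal X}
  zero_mem' := by simp [nullIdeal]
  add_mem' := by
    intro f g hf hg
    refine ⟨(measurable_measFun (f + g)) (measurableSet_singleton (0 : ℝ)).compl, fun μ hμ => ?_⟩
    refine measure_mono_null (t := {ω | (f : Ω → ℝ) ω ≠ 0} ∪ {ω | (g : Ω → ℝ) ω ≠ 0}) ?_
      (measure_union_null (hf.2 μ hμ) (hg.2 μ hμ))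
    intro ω hω
    by_contra hc
    simp only [mem_union, mem_ofPred_eq, not_or, not_not] at hc
    exact hω (by simp [hc.1, hc.2])
  smul_mem' := by
    intro c f hf
    refine ⟨(measurable_measFun (c • f)) (measurableSet_singleton (0 : ℝ)).compl, fun μ hμ => ?_⟩
    refine measure_mono_null (t := {ω | (f : Ω → ℝ) ω ≠ 0}) ?_ (hf.2 μ hμ)
    intro ω hω hc
    exact hω (by simp [hc])

/-- `L⁰(Ξ)`, for `Ξ` the null ideal of `X`: the measurable functions modulo equality outside an
element of `Ξ`. -/
abbrev L0 (X : Submodule ℝ (SignedMeasure Ω)) : Type _ := MeasFun Ω ⧸ NullFun X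

/-- The class in `L⁰(Ξ)` of a measurable function. -/
def cls (X : Submodule ℝ (SignedMeasure Ω)) (f : MeasFun Ω) : L0 X := Submodule.Quotient.mk f

theorem ae_eq_of_cls_eq {X : Submodule ℝ (SignedMeasure Ω)} {f g : MeasFun Ω}
    (h : f - g ∈ NullFun X) {μ : SignedMeasure Ω} (hμ : μ ∈ X) :
    (f : Ω → ℝ) =ᵐ[μ.variation] g := by
  have h0 := h.2 μ hμ
  rw [Filter.EventuallyEq, ae_iff]
  refine measure_mono_null ?_ h0
  intro ω hω hc
  exact hω (sub_eq_zero.mp (by simpa using hc))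

/-- The integral `∫ h dμ` of a class `h ∈ L⁰(Ξ)` against a measure `μ ∈ X`. -/
def integralL0 {X : Submodule ℝ (SignedMeasure Ω)} (μ : X) (h : L0 X) : ℝ :=
  Quotient.liftOn' h (fun f : MeasFun Ω => ∫ᵛ ω, (f : Ω → ℝ) ω ∂<•(μ : SignedMeasure Ω))
    (fun _ _ hfg => VectorMeasure.integral_congr_ae
      (ae_eq_of_cls_eq ((Submodule.quotientRel_def _).mp hfg) μ.2))

theorem integralL0_cls {X : Submodule ℝ (SignedMeasure Ω)} (μ : X) (f : MeasFun Ω) :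
    integralL0 μ (cls X f) = ∫ᵛ ω, (f : Ω → ℝ) ω ∂<•(μ : SignedMeasure Ω) := rfl

/-! ### Decomposable pairs -/

/-- The pair `(X, Y)` is `ν`-decomposable. Here `X` is a vector space of finite signed measures
and `Y ⊆ L⁰(Ξ)` a vector space of (classes of) measurable functions. -/
structure IsDecomposable (ν : Measure Ω) [IsFiniteMeasure ν]
    (X : Submodule ℝ (SignedMeasure Ω)) (Y : Submodule ℝ (L0 X)) : Prop where
  mem : ν.toSignedMeasure ∈ X
  /-- the pairing `(μ, h) ↦ ∫ h dμ` is well defined on `X × Y` ... -/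
  integrable : ∀ μ ∈ X, ∀ f : MeasFun Ω, cls X f ∈ Y → Integrable (f : Ω → ℝ) μ.variation
  /-- ... and it separates the points of `X` ... -/
  separating_left : ∀ μ : X, μ ≠ 0 → ∃ h : Y, integralL0 μ (h : L0 X) ≠ 0
  /-- ... and of `Y`. -/
  separating_right : ∀ h : Y, h ≠ 0 → ∃ μ : X, integralL0 μ (h : L0 X) ≠ 0
  /-- `X` contains all measures with an essentially bounded density with respect to `ν`. -/
  bounded_density_mem : ∀ μ : SignedMeasure Ω, μ.variation ≪ ν → MemLp (μ.rnDeriv ν) ⊤ ν → μ ∈ X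
  /-- `L^∞(Ξ) ⊆ Y`. -/
  bounded_mem : ∀ f : MeasFun Ω,
    Bornology.IsBounded (essRange (nullIdeal X) (f : Ω → ℝ)) → cls X f ∈ Y
  /-- every measurable set outside `Ξ` carries a nonzero nonnegative measure of `X`. -/
  exists_carried : ∀ A : Set Ω, MeasurableSet A → A ∉ nullIdeal X →
    ∃ μ ∈ X, 0 ≤ μ ∧ μ ≠ 0 ∧ μ Aᶜ = 0

/-- The pairing of `X` and `Y`. -/
def pairing (X : Submodule ℝ (SignedMeasure Ω)) (Y : Submodule ℝ (L0 X)) (μ : X) (h : Y) : ℝ :=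
  integralL0 μ (h : L0 X)

/-- The functional `μ ↦ D_φ(μ ‖ ν)` over `X`. -/
def divergenceOn (φ : ℝ → EReal) (ν : Measure Ω) (X : Submodule ℝ (SignedMeasure Ω)) (μ : X) :
    EReal :=
  divergence φ ν (μ : SignedMeasure Ω)

/-- The weak topology `σ(X, Y)`: the coarsest topology on `X` making all `μ ↦ ∫ h dμ`, `h ∈ Y`,
continuous. -/
abbrev weakTopology (X : Submodule ℝ (SignedMeasure Ω)) (Y : Submodule ℝ (L0 X)) :
    TopologicalSpace X :=
  TopologicalSpace.induced (fun (μ : X) (h : Y) => pairing X Y μ h) Pi.topologicalSpace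

/-- A topology on `X` is compatible with the pairing with `Y` if it is a locally convex vector
space topology whose continuous linear forms are exactly the maps `μ ↦ ∫ h dμ`, `h ∈ Y`. -/
structure IsCompatible (X : Submodule ℝ (SignedMeasure Ω)) (Y : Submodule ℝ (L0 X))
    (τ : TopologicalSpace X) : Prop where
  addGroup : @IsTopologicalAddGroup X τ _
  smul : @ContinuousSMul ℝ X _ _ τ
  locallyConvex : @LocallyConvexSpace ℝ X _ _ _ _ τ
  dual : ∀ l : X →ₗ[ℝ] ℝ,
    @Continuous X ℝ τ _ l ↔ ∃ h : Y, ∀ μ : X, l μ = pairing X Y μ h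

end PhiDiv

end

namespace PhiDiv

/-! Everything rests on countable duality. Separating points from the closed convex epigraph writes
`φ x = ⨆ n, x * y n - b n` with `b n = φ* (y n)` finite, so that `φ'(∞) = sup y n` and `φ'(-∞) = inf
y n`; dually, `φ*` is a countable supremum of lines coming from points of the graph of `φ`.

A supremum of countably many lines commutes with the integral through a measurable index `κ` of
finite range (`exists_index_lt_integral`). For the divergence, `g = y ∘ κ` is bounded, takes values
between the slopes, and can be prescribed on the `ν`-null sets carrying the singular parts. This
gives `D ≤ sup_g (∫ g dμ - ∫ φ* ∘ g dν)` over admissible `g`; the reverse inequality is the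
integrated Fenchel-Young inequality. For the conjugate, the measures with density `x ∘ κ` give `∫ φ*
∘ h dν ≤ D*(h)`, and Fenchel-Young gives equality when the essential range of `h` lies between the
slopes.

If it does not, a measure of `X` carried where `h` is close to a bad value strictly separates `h`
from all admissible functions; moving from `ν` along it, the variational formula keeps the growth of
`D` below that of the pairing with `h`, so `D*(h) = ⊤`. Semicontinuity and the biconjugate identity
follow from the variational formula. -/

/-! ### Affine minorants and conjugation on the real line -/

theorem IsDivergenceFunction.convex_epigraph {φ : ℝ → EReal} (hφ : IsDivergenceFunction φ) :
    Convex ℝ {p : ℝ × ℝ | φ p.1 ≤ (p.2 : EReal)} := by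
  rintro ⟨x, s⟩ hx ⟨y, t⟩ hy a b ha hb hab
  simp only [mem_ofPred_eq] at hx hy ⊢
  refine (hφ.convex x y a b ha hb hab).trans ?_
  have h1 : (a : EReal) * φ x ≤ (a : EReal) * (s : EReal) :=
    mul_le_mul_of_nonneg_left hx (EReal.coe_nonneg.2 ha)
  have h2 : (b : EReal) * φ y ≤ (b : EReal) * (t : EReal) :=
    mul_le_mul_of_nonneg_left hy (EReal.coe_nonneg.2 hb)
  refine (add_le_add h1 h2).trans ?_
  simp [smul_eq_mul]

theorem IsDivergenceFunction.isClosed_epigraph {φ : ℝ → EReal} (hφ : IsDivergenceFunction φ) :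
    IsClosed {p : ℝ × ℝ | φ p.1 ≤ (p.2 : EReal)} :=
  hφ.lsc.isClosed_epigraph.preimage
    (continuous_id.prodMap continuous_coe_real_ereal : Continuous
      (Prod.map id ((↑) : ℝ → EReal) : ℝ × ℝ → ℝ × EReal))

/-- A point strictly below the graph is strictly separated from the epigraph. -/
theorem IsDivergenceFunction.exists_separation {φ : ℝ → EReal} (hφ : IsDivergenceFunction φ)
    {x₀ c : ℝ} (hc : (c : EReal) < φ x₀) :
    ∃ α β u : ℝ, 0 ≤ β ∧ x₀ * α + c * β < u ∧
      ∀ x t : ℝ, φ x ≤ (t : EReal) → u < x * α + t * β := by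
  obtain ⟨f, u, h1, h2⟩ := geometric_hahn_banach_point_closed hφ.convex_epigraph
    hφ.isClosed_epigraph (x := (x₀, c)) (by simpa using hc)
  have hf : ∀ x t : ℝ, f (x, t) = x * f (1, 0) + t * f (0, 1) := by
    intro x t
    have : ((x, t) : ℝ × ℝ) = x • ((1, 0) : ℝ × ℝ) + t • ((0, 1) : ℝ × ℝ) := by simp
    rw [this, map_add, map_smul, map_smul, smul_eq_mul, smul_eq_mul]
  have h3 : ∀ x t : ℝ, φ x ≤ (t : EReal) → u < x * f (1, 0) + t * f (0, 1) := by
    intro x t hxt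
    rw [← hf]
    exact h2 _ hxt
  refine ⟨f (1, 0), f (0, 1), u, ?_, by rw [← hf]; exact h1, h3⟩
  by_contra hβ
  push Not at hβ
  -- As `φ 1 = 0`, the epigraph contains the ray above `(1, 0)`. A negative vertical coefficient
  -- would tend to `-∞` along it; this height is already large enough for a contradiction.
  have h4 := h3 1 (|f (1, 0) - u| / (- f (0, 1))) (by
    rw [hφ.map_one]
    exact EReal.coe_nonneg.2 (div_nonneg (abs_nonneg _) (by linarith)))
  have h5 : |f (1, 0) - u| / (- f (0, 1)) * f (0, 1) = - |f (1, 0) - u| := by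
    rw [div_mul_eq_mul_div, div_neg, mul_div_cancel_right₀ _ hβ.ne]
  rw [h5] at h4
  linarith [le_abs_self (f (1, 0) - u)]

theorem IsDivergenceFunction.affine_le_of_separation {φ : ℝ → EReal}
    (hφ : IsDivergenceFunction φ) {α β u : ℝ} (hβ : 0 < β)
    (h : ∀ x t : ℝ, φ x ≤ (t : EReal) → u < x * α + t * β) (x : ℝ) :
    ((x * (-α / β) - (-u / β) : ℝ) : EReal) ≤ φ x := by
  induction hx : φ x with
  | bot => exact absurd hx (hφ.ne_bot x)
  | top => exact le_top
  | coe t =>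
    have := h x t hx.le
    rw [EReal.coe_le_coe_iff]
    have e : x * (-α / β) - (-u / β) = (u - x * α) / β := by field_simp; ring
    rw [e, div_le_iff₀ hβ]
    linarith

/-- A non-vertical separating line, solved for its height, is the required minorant. A vertical one
(`β = 0`) only separates `x₀` from the domain of `φ`; it is then used to tilt a minorant found at `x
= 1`, where finiteness of `φ` excludes verticality. -/
theorem IsDivergenceFunction.exists_affine_le {φ : ℝ → EReal} (hφ : IsDivergenceFunction φ)
    {x₀ c : ℝ} (hc : (c : EReal) < φ x₀) :
    ∃ y b : ℝ, (∀ x : ℝ, ((x * y - b : ℝ) : EReal) ≤ φ x) ∧ c < x₀ * y - b := by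
  obtain ⟨α, β, u, hβ, h1, h2⟩ := hφ.exists_separation hc
  rcases hβ.eq_or_lt with rfl | hβ
  · obtain ⟨α', β', u', hβ', h1', h2'⟩ := hφ.exists_separation (x₀ := 1) (c := -1) (by
      rw [hφ.map_one]; exact_mod_cast neg_one_lt_zero)
    have hpos : 0 < β' := by
      have := h2' 1 0 (by rw [hφ.map_one]; rfl)
      linarith
    have hmin := hφ.affine_le_of_separation hpos h2'
    set y := -α' / β'
    set b := -u' / β'
    -- Adding `k * (u - x * α)` lowers the line on the domain of `φ` and raises it at `x₀` by `k *
    -- (u - x₀ * α)`, so a large `k` passes `c`.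
    obtain ⟨k, hk⟩ := exists_nat_gt ((c - (x₀ * y - b)) / (u - x₀ * α))
    have hd : 0 < u - x₀ * α := by linarith
    rw [div_lt_iff₀ hd] at hk
    refine ⟨y - k * α, b - k * u, fun x => ?_, by linarith⟩
    induction hx : φ x with
    | bot => exact absurd hx (hφ.ne_bot x)
    | top => exact le_top
    | coe t =>
      have h3 := h2 x t hx.le
      have h4 := hmin x
      rw [hx, EReal.coe_le_coe_iff] at h4
      rw [EReal.coe_le_coe_iff]
      have h5 : 0 ≤ (k : ℝ) * (x * α - u) := mul_nonneg k.cast_nonneg (by linarith)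
      linarith
  · refine ⟨_, _, hφ.affine_le_of_separation hβ h2, ?_⟩
    have e : x₀ * (-α / β) - (-u / β) = (u - x₀ * α) / β := by field_simp; ring
    rw [e, lt_div_iff₀ hβ]
    linarith

/-- The test point `x = 1` gives this bound. It keeps `φ*` away from `⊥` and makes `h` itself an
integrable minorant of `φ* ∘ h`. -/
theorem IsDivergenceFunction.le_realConjugate {φ : ℝ → EReal} (hφ : IsDivergenceFunction φ)
    (y : ℝ) : (y : EReal) ≤ realConjugate φ y := by
  have h : ((1 * y : ℝ) : EReal) - φ 1 ≤ realConjugate φ y :=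
    le_iSup (fun x : ℝ => ((x * y : ℝ) : EReal) - φ x) 1
  rwa [hφ.map_one, one_mul, sub_zero] at h

/-- The Fenchel-Young inequality. -/
theorem IsDivergenceFunction.young {φ : ℝ → EReal} (hφ : IsDivergenceFunction φ) (x y : ℝ) :
    ((x * y : ℝ) : EReal) ≤ φ x + realConjugate φ y := by
  have h : ((x * y : ℝ) : EReal) - φ x ≤ realConjugate φ y :=
    le_iSup (fun x : ℝ => ((x * y : ℝ) : EReal) - φ x) x
  have hb : realConjugate φ y ≠ ⊥ := ne_bot_of_le_ne_bot (EReal.coe_ne_bot y) (hφ.le_realConjugate y)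
  rw [EReal.sub_le_iff_le_add (Or.inl (hφ.ne_bot x)) (Or.inr hb)] at h
  rwa [add_comm]

/-- A family of affine functions has the same strict lower bounds as a sequence in it. -/
theorem exists_seq_affine {G : Set (ℝ × ℝ)} (hG : G.Nonempty) :
    ∃ p : ℕ → ℝ × ℝ, (∀ n, p n ∈ G) ∧ ∀ q ∈ G, ∀ x c : ℝ, c < x * q.1 - q.2 →
      ∃ n, c < x * (p n).1 - (p n).2 := by
  have : Nonempty G := hG.to_subtype
  obtain ⟨p, hp⟩ := TopologicalSpace.exists_dense_seq G
  refine ⟨fun n => p n, fun n => (p n).2, fun q hq x c hc => ?_⟩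
  have ho : IsOpen {r : G | c < x * (r : ℝ × ℝ).1 - (r : ℝ × ℝ).2} :=
    isOpen_lt continuous_const (by fun_prop)
  obtain ⟨n, hn⟩ := hp.exists_mem_open ho ⟨⟨q, hq⟩, hc⟩
  exact ⟨n, hn⟩

/-- A divergence function is the supremum of a sequence of affine functions that are determined by
the graph of its conjugate. -/
theorem IsDivergenceFunction.exists_seq_eq_iSup {φ : ℝ → EReal} (hφ : IsDivergenceFunction φ) :
    ∃ y b : ℕ → ℝ, (∀ n, realConjugate φ (y n) = b n) ∧
      ∀ x : ℝ, φ x = ⨆ n, ((x * y n - b n : ℝ) : EReal) := by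
  have key : ∀ x₀ c : ℝ, (c : EReal) < φ x₀ →
      ∃ q ∈ {p : ℝ × ℝ | realConjugate φ p.1 = p.2}, c < x₀ * q.1 - q.2 := by
    intro x₀ c hc
    obtain ⟨y, b, h1, h2⟩ := hφ.exists_affine_le hc
    -- Replacing `b` by `φ* y`, finite and at most `b`, only raises the line.
    have hle : realConjugate φ y ≤ b := by
      refine iSup_le fun x => EReal.sub_le_of_le_add ?_
      calc ((x * y : ℝ) : EReal) = (b : EReal) + ((x * y - b : ℝ) : EReal) := by
            rw [← EReal.coe_add]; congr 1; ring
        _ ≤ b + φ x := add_le_add le_rfl (h1 x)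
    have hge := hφ.le_realConjugate y
    induction hr : realConjugate φ y with
    | bot => simp [hr] at hge
    | top => simp [hr] at hle
    | coe t =>
      rw [hr, EReal.coe_le_coe_iff] at hle
      exact ⟨(y, t), hr, by simp only; linarith⟩
  obtain ⟨q₀, hq₀, -⟩ := key 1 (-1) (by rw [hφ.map_one]; exact_mod_cast neg_one_lt_zero)
  obtain ⟨p, hp, hp'⟩ := exists_seq_affine ⟨q₀, hq₀⟩
  refine ⟨fun n => (p n).1, fun n => (p n).2, hp, fun x => le_antisymm ?_ (iSup_le fun n => ?_)⟩
  · refine EReal.ge_of_forall_gt_iff_ge.1 fun c hc => ?_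
    obtain ⟨q, hq, hlt⟩ := key x c hc
    obtain ⟨n, hn⟩ := hp' q hq x c hlt
    exact le_iSup_of_le n (EReal.coe_le_coe_iff.2 hn.le)
  · have := hφ.young x (p n).1
    rw [show realConjugate φ (p n).1 = (p n).2 from hp n] at this
    rw [EReal.coe_sub]
    exact EReal.sub_le_of_le_add this

/-- Points where `φ = ⊤` contribute `⊥` to the supremum, so the finite part of the graph of `φ`
suffices, and a dense sequence in it gives the same supremum. -/
theorem IsDivergenceFunction.exists_seq_realConjugate_eq_iSup {φ : ℝ → EReal}
    (hφ : IsDivergenceFunction φ) :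
    ∃ x c : ℕ → ℝ, (∀ n, φ (x n) = c n) ∧
      ∀ y : ℝ, realConjugate φ y = ⨆ n, ((y * x n - c n : ℝ) : EReal) := by
  obtain ⟨p, hp, hp'⟩ := exists_seq_affine (G := {p : ℝ × ℝ | φ p.1 = p.2})
    ⟨(1, 0), by simp [hφ.map_one]⟩
  refine ⟨fun n => (p n).1, fun n => (p n).2, hp, fun y => le_antisymm ?_ (iSup_le fun n => ?_)⟩
  · refine iSup_le fun x => ?_
    induction hx : φ x with
    | bot => exact absurd hx (hφ.ne_bot x)
    | top => simp
    | coe t =>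
      rw [← EReal.coe_sub]
      refine EReal.ge_of_forall_gt_iff_ge.1 fun z hz => ?_
      rw [EReal.coe_lt_coe_iff] at hz
      replace hz : z < y * x - t := by rw [mul_comm]; exact hz
      obtain ⟨n, hn⟩ := hp' (x, t) hx y z hz
      exact le_iSup_of_le n (EReal.coe_le_coe_iff.2 hn.le)
  · have := hφ.young (p n).1 y
    rw [show φ (p n).1 = (p n).2 from hp n] at this
    rw [EReal.coe_sub, mul_comm]
    exact EReal.sub_le_of_le_add' this

/-! ### Slopes at infinity of a supremum of affine functions -/

/-- Each line gives the lower bound `a n - b n / x`. For the upper bound, `F x₁ ≤ 0` forces `b n ≥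
x₁ * a n` for all `n` at once, hence `F x ≤ (x - x₁) * r` for `x > x₁` and any `r` above all slopes.
-/
theorem tendsto_div_atTop_of_eq_iSup {F : ℝ → EReal} {a b : ℕ → ℝ}
    (hF : ∀ x : ℝ, F x = ⨆ n, ((x * a n - b n : ℝ) : EReal)) {x₁ : ℝ} (hx₁ : F x₁ ≤ 0) :
    Tendsto (fun x : ℝ => F x / (x : EReal)) atTop (𝓝 (⨆ n, (a n : EReal))) := by
  have hb : ∀ n, x₁ * a n ≤ b n := by
    intro n
    have h := (le_iSup (fun n => ((x₁ * a n - b n : ℝ) : EReal)) n).trans ((hF x₁).symm.le.trans hx₁)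
    have h' : x₁ * a n - b n ≤ 0 := by exact_mod_cast h
    linarith
  have lim : ∀ r s : ℝ, Tendsto (fun x : ℝ => ((r - s / x : ℝ) : EReal)) atTop (𝓝 (r : EReal)) := by
    intro r s
    refine (continuous_coe_real_ereal.tendsto r).comp ?_
    simpa using tendsto_const_nhds.sub (tendsto_const_nhds.div_atTop (tendsto_id (α := ℝ)))
  refine tendsto_order.2 ⟨fun c hc => ?_, fun c hc => ?_⟩
  · obtain ⟨n, hn⟩ := lt_iSup_iff.1 hc
    filter_upwards [(lim (a n) (b n)).eventually (lt_mem_nhds hn), eventually_gt_atTop 0]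
      with x hx hx0
    refine hx.trans_le ?_
    have e : a n - b n / x = (x * a n - b n) / x := by field_simp
    rw [e, EReal.coe_div]
    refine EReal.div_le_div_right_of_nonneg (EReal.coe_nonneg.2 hx0.le) ?_
    rw [hF]
    exact le_iSup (fun n => ((x * a n - b n : ℝ) : EReal)) n
  · obtain ⟨r, hr1, hr2⟩ := EReal.lt_iff_exists_real_btwn.1 hc
    have har : ∀ n, a n ≤ r := fun n => by
      exact_mod_cast ((le_iSup (fun n => (a n : EReal)) n).trans hr1.le)
    filter_upwards [(lim r (x₁ * r)).eventually (gt_mem_nhds hr2), eventually_gt_atTop 0,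
      eventually_gt_atTop x₁] with x hx hx0 hx1
    refine lt_of_le_of_lt ?_ hx
    have e : r - x₁ * r / x = (x * r - x₁ * r) / x := by field_simp
    rw [e, EReal.coe_div]
    refine EReal.div_le_div_right_of_nonneg (EReal.coe_nonneg.2 hx0.le) ?_
    rw [hF]
    refine iSup_le fun n => EReal.coe_le_coe_iff.2 ?_
    nlinarith [har n, hb n]

theorem neg_iSup_neg_coe (a : ℕ → ℝ) : -(⨆ n, ((-a n : ℝ) : EReal)) = ⨅ n, (a n : EReal) := by
  refine le_antisymm (le_iInf fun n => ?_) (EReal.le_neg_of_le_neg (iSup_le fun n => ?_))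
  · rw [EReal.neg_le]
    exact le_iSup (fun n => ((-a n : ℝ) : EReal)) n
  · rw [EReal.coe_neg, EReal.neg_le_neg_iff]
    exact iInf_le _ n

theorem slopeTop_eq_iSup {φ : ℝ → EReal} (hφ : IsDivergenceFunction φ) {a b : ℕ → ℝ}
    (hF : ∀ x : ℝ, φ x = ⨆ n, ((x * a n - b n : ℝ) : EReal)) :
    slopeTop φ = ⨆ n, (a n : EReal) :=
  (tendsto_div_atTop_of_eq_iSup hF hφ.map_one.le).limUnder_eq

theorem slopeBot_eq_iInf {φ : ℝ → EReal} (hφ : IsDivergenceFunction φ) {a b : ℕ → ℝ}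
    (hF : ∀ x : ℝ, φ x = ⨆ n, ((x * a n - b n : ℝ) : EReal)) :
    slopeBot φ = ⨅ n, (a n : EReal) := by
  -- The reflected function has slopes `-a n` and vanishes at `-1`.
  have h := tendsto_div_atTop_of_eq_iSup (F := fun x => φ (-x)) (a := fun n => -a n) (b := b)
    (x₁ := -1) (fun x => by simp [hF]) (by simp [hφ.map_one])
  have h2 := ((continuous_neg.tendsto _).comp h).comp tendsto_neg_atBot_atTop
  rw [neg_iSup_neg_coe] at h2
  refine Tendsto.limUnder_eq (h2.congr fun x => ?_)
  simp [EReal.div_eq_inv_mul, EReal.inv_neg]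

theorem measurable_of_eq_iSup {F : ℝ → EReal} {a b : ℕ → ℝ}
    (hF : ∀ x : ℝ, F x = ⨆ n, ((x * a n - b n : ℝ) : EReal)) : Measurable F := by
  rw [funext hF]
  exact Measurable.iSup fun n => (by fun_prop : Measurable fun x : ℝ => x * a n - b n).coe_real_ereal

variable {Ω : Type*} [MeasurableSpace Ω] {ν : Measure Ω}

/-! ### The extended integral -/

theorem extIntegral_congr_ae {F G : Ω → EReal} (h : F =ᵐ[ν] G) :
    extIntegral ν F = extIntegral ν G := by
  unfold extIntegral
  congr 2 <;> refine lintegral_congr_ae ?_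
  all_goals filter_upwards [h] with ω hω using by rw [hω]

theorem extIntegral_mono_ae {F G : Ω → EReal} (h : F ≤ᵐ[ν] G) :
    extIntegral ν F ≤ extIntegral ν G := by
  unfold extIntegral
  refine EReal.sub_le_sub ?_ ?_ <;> refine EReal.coe_ennreal_le_coe_ennreal_iff.2 ?_ <;>
    refine lintegral_mono_ae ?_
  · filter_upwards [h] with ω hω using EReal.toENNReal_le_toENNReal hω
  · filter_upwards [h] with ω hω using EReal.toENNReal_le_toENNReal (EReal.neg_le_neg_iff.2 hω)

theorem extIntegral_coe {u : Ω → ℝ} (hu : Integrable u ν) :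
    extIntegral ν (fun ω => (u ω : EReal)) = ((∫ ω, u ω ∂ν : ℝ) : EReal) := by
  have h1 : ∫⁻ ω, ENNReal.ofReal (u ω) ∂ν ≠ ⊤ := hu.lintegral_lt_top.ne
  have h2 : ∫⁻ ω, ENNReal.ofReal (-u ω) ∂ν ≠ ⊤ := hu.neg.lintegral_lt_top.ne
  rw [integral_eq_lintegral_pos_part_sub_lintegral_neg_part hu, EReal.coe_sub,
    EReal.coe_ennreal_toReal h1, EReal.coe_ennreal_toReal h2]
  simp only [extIntegral, ← EReal.coe_neg, EReal.toENNReal_of_ne_top (EReal.coe_ne_top _),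
    EReal.toReal_coe]

/-- This is `x = (x - r) + r` in positive and negative parts, with every term moved to the side
where it is added, so that it can be integrated in `ℝ≥0∞`. -/
theorem toENNReal_add_ofReal_neg {x : EReal} {r : ℝ} (h : (r : EReal) ≤ x) :
    x.toENNReal + ENNReal.ofReal (-r)
      = (x - r).toENNReal + (ENNReal.ofReal r + (-x).toENNReal) := by
  induction x with
  | bot => simp at h
  | top => simp
  | coe t =>
    rw [EReal.coe_le_coe_iff] at h
    simp only [← EReal.coe_neg, ← EReal.coe_sub, EReal.toENNReal_of_ne_top (EReal.coe_ne_top _),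
      EReal.toReal_coe]
    rcases le_total 0 r with hr | hr
    · rw [ENNReal.ofReal_of_nonpos (by linarith : -r ≤ 0),
        ENNReal.ofReal_of_nonpos (by linarith : -t ≤ 0), add_zero, add_zero,
        ← ENNReal.ofReal_add (by linarith) hr]
      congr 1; ring
    · rw [ENNReal.ofReal_of_nonpos hr, zero_add]
      rcases le_total 0 t with ht | ht
      · rw [ENNReal.ofReal_of_nonpos (by linarith : -t ≤ 0), add_zero,
          ← ENNReal.ofReal_add ht (by linarith)]
        congr 1
      · rw [ENNReal.ofReal_of_nonpos ht, zero_add, ← ENNReal.ofReal_add (by linarith) (by linarith)]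
        congr 1; ring

/-- The extended integral of a function with an integrable minorant. -/
theorem extIntegral_eq_add_lintegral {F : Ω → EReal} (hF : Measurable F) {u : Ω → ℝ}
    (hu : Integrable u ν) (huF : ∀ᵐ ω ∂ν, (u ω : EReal) ≤ F ω) :
    extIntegral ν F = ((∫ ω, u ω ∂ν : ℝ) : EReal)
      + ((∫⁻ ω, (F ω - u ω).toENNReal ∂ν : ℝ≥0∞) : EReal) := by
  have hum : AEMeasurable u ν := hu.aemeasurable
  have h1 : ∫⁻ ω, ENNReal.ofReal (u ω) ∂ν ≠ ⊤ := hu.lintegral_lt_top.ne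
  have h2 : ∫⁻ ω, ENNReal.ofReal (-u ω) ∂ν ≠ ⊤ := hu.neg.lintegral_lt_top.ne
  have h3 : ∫⁻ ω, (-F ω).toENNReal ∂ν ≠ ⊤ := by
    refine ne_top_of_le_ne_top h2 (lintegral_mono_ae ?_)
    filter_upwards [huF] with ω hω
    refine (EReal.toENNReal_le_toENNReal (EReal.neg_le_neg_iff.2 hω)).trans_eq ?_
    rw [← EReal.coe_neg, EReal.toENNReal_of_ne_top (EReal.coe_ne_top _), EReal.toReal_coe]
  have key : ∫⁻ ω, (F ω).toENNReal ∂ν + ∫⁻ ω, ENNReal.ofReal (-u ω) ∂ν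
      = ∫⁻ ω, (F ω - u ω).toENNReal ∂ν
        + (∫⁻ ω, ENNReal.ofReal (u ω) ∂ν + ∫⁻ ω, (-F ω).toENNReal ∂ν) := by
    have hm : AEMeasurable (fun ω => ENNReal.ofReal (u ω) + (-F ω).toENNReal) ν :=
      hum.ennreal_ofReal.add hF.neg.ereal_toENNReal.aemeasurable
    rw [← lintegral_add_left hF.ereal_toENNReal, ← lintegral_add_left' hum.ennreal_ofReal,
      ← lintegral_add_right' _ hm]
    refine lintegral_congr_ae ?_
    filter_upwards [huF] with ω hω using toENNReal_add_ofReal_neg hω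
  rw [integral_eq_lintegral_pos_part_sub_lintegral_neg_part hu, extIntegral]
  generalize ∫⁻ ω, (F ω).toENNReal ∂ν = p at *
  generalize ∫⁻ ω, (F ω - u ω).toENNReal ∂ν = q at *
  lift ∫⁻ ω, ENNReal.ofReal (u ω) ∂ν to NNReal using h1 with a
  lift ∫⁻ ω, ENNReal.ofReal (-u ω) ∂ν to NNReal using h2 with b
  lift ∫⁻ ω, (-F ω).toENNReal ∂ν to NNReal using h3 with d
  -- The other three integrals are finite, so `key` makes `p` and `q` infinite together.
  induction p using ENNReal.recTopCoe with
  | top =>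
    have : q = ⊤ := by
      by_contra hq
      lift q to NNReal using hq
      simp [← ENNReal.coe_add] at key
    subst this
    simp [sub_eq_add_neg]
  | coe p =>
    have : q ≠ ⊤ := by
      rintro rfl
      simp [← ENNReal.coe_add] at key
    lift q to NNReal using this
    have key' : (p : ℝ) + b = q + (a + d) := by exact_mod_cast key
    have e : ∀ r : NNReal, (((r : ℝ≥0∞)) : EReal) = ((r : ℝ) : EReal) := fun r => rfl
    rw [e, e, e, ← EReal.coe_sub, ← EReal.coe_add, EReal.coe_eq_coe_iff]
    simp only [ENNReal.coe_toReal]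
    linarith

theorem extIntegral_ne_bot {F : Ω → EReal} {u : Ω → ℝ}
    (hu : Integrable u ν) (huF : ∀ᵐ ω ∂ν, (u ω : EReal) ≤ F ω) : extIntegral ν F ≠ ⊥ := by
  refine ne_bot_of_le_ne_bot (EReal.coe_ne_bot (∫ ω, u ω ∂ν)) ?_
  rw [← extIntegral_coe hu]
  exact extIntegral_mono_ae huF

/-- Subtracting the integrable minorants leaves nonnegative functions, whose integrals add without
any `∞ - ∞`. -/
theorem integral_le_extIntegral_add {F G : Ω → EReal} (hF : Measurable F) (hG : Measurable G)
    {u v w : Ω → ℝ} (hu : Integrable u ν) (hv : Integrable v ν) (hw : Integrable w ν)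
    (huF : ∀ᵐ ω ∂ν, (u ω : EReal) ≤ F ω) (hvG : ∀ᵐ ω ∂ν, (v ω : EReal) ≤ G ω)
    (h : ∀ᵐ ω ∂ν, (w ω : EReal) ≤ F ω + G ω) :
    ((∫ ω, w ω ∂ν : ℝ) : EReal) ≤ extIntegral ν F + extIntegral ν G := by
  rw [extIntegral_eq_add_lintegral hF hu huF, extIntegral_eq_add_lintegral hG hv hvG,
    add_add_add_comm, ← EReal.coe_add, ← EReal.coe_ennreal_add]
  have hd : Integrable (fun ω => w ω - (u ω + v ω)) ν := hw.sub (hu.add hv)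
  have h1 : ∫ ω, w ω ∂ν = (∫ ω, u ω ∂ν + ∫ ω, v ω ∂ν) + ∫ ω, (w ω - (u ω + v ω)) ∂ν := by
    have h0 : Integrable (fun ω => u ω + v ω) ν := hu.add hv
    rw [integral_sub hw h0, integral_add hu hv]; ring
  rw [h1, EReal.coe_add]
  refine add_le_add le_rfl ?_
  have hum : AEMeasurable u ν := hu.aemeasurable
  have h2 : ∫⁻ ω, ENNReal.ofReal (w ω - (u ω + v ω)) ∂ν
      ≤ ∫⁻ ω, (F ω - u ω).toENNReal ∂ν + ∫⁻ ω, (G ω - v ω).toENNReal ∂ν := by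
    have hm : AEMeasurable (fun ω => (F ω - u ω).toENNReal) ν :=
      (hF.aemeasurable.sub hum.coe_real_ereal).ereal_toENNReal
    rw [← lintegral_add_left' hm]
    refine lintegral_mono_ae ?_
    filter_upwards [huF, hvG, h] with ω h1 h2 h3
    generalize F ω = x at *
    generalize G ω = y at *
    induction x with
    | bot => simp at h1
    | top => simp
    | coe x =>
      induction y with
      | bot => simp at h2
      | top => simp
      | coe y =>
        rw [EReal.coe_le_coe_iff] at h1 h2
        rw [← EReal.coe_add, EReal.coe_le_coe_iff] at h3
        simp only [← EReal.coe_sub, EReal.toENNReal_of_ne_top (EReal.coe_ne_top _),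
          EReal.toReal_coe]
        rw [← ENNReal.ofReal_add (by linarith) (by linarith)]
        exact ENNReal.ofReal_le_ofReal (by linarith)
  refine le_trans ?_ (EReal.coe_ennreal_le_coe_ennreal_iff.2 h2)
  rw [integral_eq_lintegral_pos_part_sub_lintegral_neg_part hd, EReal.coe_sub,
    EReal.coe_ennreal_toReal hd.lintegral_lt_top.ne]
  refine EReal.sub_le_of_le_add (le_add_of_nonneg_right ?_)
  exact EReal.coe_nonneg.2 ENNReal.toReal_nonneg

/-- Monotone convergence for the extended integral. -/
theorem exists_lt_integral_of_lt_extIntegral {F : Ω → EReal} (hF : Measurable F) {f : ℕ → Ω → ℝ}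
    (hfm : ∀ n, Measurable (f n)) (hf : ∀ n, Integrable (f n) ν)
    (hmono : ∀ ω, Monotone fun n => f n ω) (hFf : ∀ ω, F ω = ⨆ n, (f n ω : EReal)) {c : ℝ}
    (hc : (c : EReal) < extIntegral ν F) : ∃ n, c < ∫ ω, f n ω ∂ν := by
  by_contra! hcon
  refine hc.not_ge ?_
  rw [extIntegral_eq_add_lintegral hF (hf 0)
    (ae_of_all _ fun ω => by rw [hFf]; exact le_iSup (fun n => (f n ω : EReal)) 0)]
  have h1 : ∀ ω, (F ω - f 0 ω).toENNReal = ⨆ n, ENNReal.ofReal (f n ω - f 0 ω) := by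
    intro ω
    refine le_antisymm ?_ (iSup_le fun n => ?_)
    · have : F ω - f 0 ω ≤ ((⨆ n, ENNReal.ofReal (f n ω - f 0 ω) : ℝ≥0∞) : EReal) := by
        refine EReal.sub_le_of_le_add ?_
        rw [hFf]
        refine iSup_le fun n => ?_
        have h2 : ((f n ω - f 0 ω : ℝ) : EReal)
            ≤ ((⨆ n, ENNReal.ofReal (f n ω - f 0 ω) : ℝ≥0∞) : EReal) := by
          refine le_trans ?_ (EReal.coe_ennreal_le_coe_ennreal_iff.2
            (le_iSup (fun n => ENNReal.ofReal (f n ω - f 0 ω)) n))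
          rw [EReal.coe_ennreal_ofReal]
          exact EReal.coe_le_coe_iff.2 (le_max_left _ _)
        calc (f n ω : EReal) = ((f n ω - f 0 ω : ℝ) : EReal) + (f 0 ω : EReal) := by
              rw [← EReal.coe_add]; congr 1; ring
          _ ≤ _ := add_le_add h2 le_rfl
      refine (EReal.toENNReal_le_toENNReal this).trans_eq ?_
      simp
    · have h2 : ((f n ω - f 0 ω : ℝ) : EReal) ≤ F ω - f 0 ω := by
        rw [EReal.coe_sub, hFf]
        exact EReal.sub_le_sub (le_iSup (fun n => (f n ω : EReal)) n) le_rfl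
      refine le_trans (le_of_eq ?_) (EReal.toENNReal_le_toENNReal h2)
      rw [EReal.toENNReal_of_ne_top (EReal.coe_ne_top _), EReal.toReal_coe]
  have hm : ∀ n, Measurable fun ω => ENNReal.ofReal (f n ω - f 0 ω) :=
    fun n => ((hfm n).sub (hfm 0)).ennreal_ofReal
  rw [lintegral_congr h1, lintegral_iSup hm
    (fun m n hmn ω => ENNReal.ofReal_le_ofReal (sub_le_sub_right (hmono ω hmn) _))]
  have h3 : ⨆ n, ∫⁻ ω, ENNReal.ofReal (f n ω - f 0 ω) ∂ν
      ≤ ENNReal.ofReal (c - ∫ ω, f 0 ω ∂ν) := by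
    refine iSup_le fun n => ?_
    have hi : Integrable (fun ω => f n ω - f 0 ω) ν := (hf n).sub (hf 0)
    rw [← ofReal_integral_eq_lintegral_ofReal hi
      (ae_of_all _ fun ω => sub_nonneg.2 (hmono ω n.zero_le))]
    refine ENNReal.ofReal_le_ofReal ?_
    rw [integral_sub (hf n) (hf 0)]
    exact sub_le_sub_right (hcon n) _
  calc _ ≤ ((∫ ω, f 0 ω ∂ν : ℝ) : EReal) + ((ENNReal.ofReal (c - ∫ ω, f 0 ω ∂ν) : ℝ≥0∞) : EReal) :=
        add_le_add le_rfl (EReal.coe_ennreal_le_coe_ennreal_iff.2 h3)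
    _ = c := by
        rw [EReal.coe_ennreal_ofReal, max_eq_left (sub_nonneg.2 (hcon 0)), ← EReal.coe_add]
        congr 1; ring

/-! ### Measurable selection of an almost maximal affine function -/

open Classical in
/-- The index of a maximal element among the first `n + 1` values of a sequence. -/
noncomputable def argmaxIndex (v : ℕ → ℝ) : ℕ → ℕ
  | 0 => 0
  | n + 1 => if v (argmaxIndex v n) < v (n + 1) then n + 1 else argmaxIndex v n

theorem argmaxIndex_le (v : ℕ → ℝ) (n : ℕ) : argmaxIndex v n ≤ n := by
  induction n with
  | zero => rfl
  | succ n ih => rw [argmaxIndex]; split_ifs <;> omega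

theorem monotone_apply_argmaxIndex (v : ℕ → ℝ) : Monotone fun n => v (argmaxIndex v n) := by
  refine monotone_nat_of_le_succ fun n => ?_
  simp only [argmaxIndex]
  split_ifs with h
  · exact h.le
  · exact le_rfl

theorem le_apply_argmaxIndex (v : ℕ → ℝ) (n : ℕ) : v n ≤ v (argmaxIndex v n) := by
  cases n with
  | zero => rfl
  | succ n =>
    rw [argmaxIndex]
    split_ifs with h
    · exact le_rfl
    · exact not_lt.1 h

theorem measurable_argmaxIndex {v : ℕ → Ω → ℝ} (hv : ∀ n, Measurable (v n)) (n : ℕ) :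
    Measurable fun ω => argmaxIndex (fun k => v k ω) n := by
  induction n with
  | zero => exact measurable_const
  | succ n ih =>
    simp only [argmaxIndex]
    refine Measurable.ite (measurableSet_lt ?_ (hv _)) measurable_const ih
    have : Measurable fun p : ℕ × Ω => v p.1 p.2 := measurable_from_prod_countable_right hv
    exact this.comp (ih.prodMk measurable_id)

theorem integrable_mul_comp_sub_comp [IsFiniteMeasure ν] {h : Ω → ℝ} (hh : Integrable h ν)
    (a b : ℕ → ℝ) {κ : Ω → ℕ} (hκ : Measurable κ) {N : ℕ} (hN : ∀ ω, κ ω ≤ N) :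
    Integrable (fun ω => h ω * a (κ ω)) ν ∧ Integrable (fun ω => b (κ ω)) ν := by
  have key : ∀ a : ℕ → ℝ, ∃ C, ∀ ω, ‖a (κ ω)‖ ≤ C := fun a =>
    ⟨∑ i ∈ Finset.range (N + 1), ‖a i‖, fun ω => Finset.single_le_sum (f := fun i => ‖a i‖)
      (fun _ _ => norm_nonneg _) (Finset.mem_range.2 (Nat.lt_succ_of_le (hN ω)))⟩
  have hm : ∀ a : ℕ → ℝ, Measurable fun ω => a (κ ω) := fun a =>
    (measurable_of_countable a).comp hκ
  obtain ⟨C, hC⟩ := key a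
  obtain ⟨C', hC'⟩ := key b
  exact ⟨hh.mul_bdd (hm a).aestronglyMeasurable (ae_of_all _ hC),
    Integrable.of_bound (hm b).aestronglyMeasurable C' (ae_of_all _ hC')⟩

/-- The best of the first `n + 1` lines at `h ω` increases to `F (h ω)`, so monotone convergence
reaches `c` at a finite `n`. The bound on `κ` makes any sequence composed with it a bounded
function. -/
theorem exists_index_lt_integral [IsFiniteMeasure ν] {F : ℝ → EReal} {a b : ℕ → ℝ}
    (hF : ∀ x : ℝ, F x = ⨆ n, ((x * a n - b n : ℝ) : EReal)) {h : Ω → ℝ} (hm : Measurable h)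
    (hh : Integrable h ν) {c : ℝ} (hc : (c : EReal) < extIntegral ν (fun ω => F (h ω))) :
    ∃ κ : Ω → ℕ, Measurable κ ∧ (∃ N, ∀ ω, κ ω ≤ N) ∧
      c < ∫ ω, (h ω * a (κ ω) - b (κ ω)) ∂ν := by
  have hv : ∀ n, Measurable fun ω => h ω * a n - b n := fun n => by fun_prop
  have hκ := measurable_argmaxIndex hv
  have hκN : ∀ n ω, argmaxIndex (fun k => h ω * a k - b k) n ≤ n := fun n ω => argmaxIndex_le _ n
  have hfm : ∀ n, Measurable fun ω => (fun k => h ω * a k - b k)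
      (argmaxIndex (fun k => h ω * a k - b k) n) := fun n =>
    (hm.mul ((measurable_of_countable a).comp (hκ n))).sub ((measurable_of_countable b).comp (hκ n))
  have hfi : ∀ n, Integrable (fun ω => (fun k => h ω * a k - b k)
      (argmaxIndex (fun k => h ω * a k - b k) n)) ν := fun n => by
    obtain ⟨h1, h2⟩ := integrable_mul_comp_sub_comp hh a b (hκ n) (hκN n)
    exact h1.sub h2
  obtain ⟨n, hn⟩ := exists_lt_integral_of_lt_extIntegral
    ((measurable_of_eq_iSup hF).comp hm) hfm hfi
    (fun ω => monotone_apply_argmaxIndex (fun k => h ω * a k - b k)) (fun ω => by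
      rw [Function.comp_apply, hF]
      refine le_antisymm (iSup_le fun n => le_iSup_of_le n ?_) (iSup_le fun n => ?_)
      · exact EReal.coe_le_coe_iff.2 (le_apply_argmaxIndex (fun k => h ω * a k - b k) n)
      · exact le_iSup (fun k => ((h ω * a k - b k : ℝ) : EReal)) _) hc
  exact ⟨_, hκ n, ⟨n, hκN n⟩, hn⟩

/-! ### Integration against signed measures -/

theorem integral_eq_posPart_sub_negPart {μ : SignedMeasure Ω} {h : Ω → ℝ}
    (hh : Integrable h μ.variation) :
    ∫ᵛ ω, h ω ∂<•μ = ∫ ω, h ω ∂μ.toJordanDecomposition.posPart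
      - ∫ ω, h ω ∂μ.toJordanDecomposition.negPart := by
  rw [← SignedMeasure.totalVariation_eq_variation, SignedMeasure.totalVariation,
    integrable_add_measure] at hh
  conv_lhs => rw [← μ.toSignedMeasure_toJordanDecomposition, JordanDecomposition.toSignedMeasure]
  rw [VectorMeasure.integral_sub_vectorMeasure, VectorMeasure.integral_toSignedMeasure,
    VectorMeasure.integral_toSignedMeasure]
  · rw [VectorMeasure.Integrable, Measure.variation_toSignedMeasure]; exact hh.1
  · rw [VectorMeasure.Integrable, Measure.variation_toSignedMeasure]; exact hh.2

theorem toJordanDecomposition_singularPart (μ : SignedMeasure Ω) (ν : Measure Ω) :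
    (μ.singularPart ν).toJordanDecomposition
      = ⟨μ.toJordanDecomposition.posPart.singularPart ν,
          μ.toJordanDecomposition.negPart.singularPart ν,
          SignedMeasure.singularPart_mutuallySingular μ ν⟩ :=
  SignedMeasure.toJordanDecomposition_eq rfl

theorem integral_lebesgue_decomposition [IsFiniteMeasure ν] {m : Measure Ω} [IsFiniteMeasure m]
    {h : Ω → ℝ} (hh : Integrable h m) :
    Integrable h (m.singularPart ν) ∧ Integrable (fun ω => h ω * (m.rnDeriv ν ω).toReal) ν ∧
      ∫ ω, h ω ∂m = ∫ ω, h ω * (m.rnDeriv ν ω).toReal ∂ν + ∫ ω, h ω ∂m.singularPart ν := by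
  have hm := m.haveLebesgueDecomposition_add ν
  have hh' := hh
  rw [hm, integrable_add_measure] at hh'
  have e : (fun ω => h ω * (m.rnDeriv ν ω).toReal) = fun ω => (m.rnDeriv ν ω).toReal • h ω := by
    ext ω; rw [smul_eq_mul, mul_comm]
  refine ⟨hh'.1, ?_, ?_⟩
  · rw [e]
    exact (integrable_withDensity_iff_integrable_smul' (Measure.measurable_rnDeriv _ _)
      (Measure.rnDeriv_lt_top _ _)).1 hh'.2
  · conv_lhs => rw [hm]
    rw [integral_add_measure hh'.1 hh'.2, integral_withDensity_eq_integral_toReal_smul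
      (Measure.measurable_rnDeriv _ _) (Measure.rnDeriv_lt_top _ _), add_comm, e]

theorem integral_lebesgue_jordan [IsFiniteMeasure ν] {μ : SignedMeasure Ω} {h : Ω → ℝ}
    (hh : Integrable h μ.variation) :
    Integrable h (μ.singularPart ν).toJordanDecomposition.posPart ∧
    Integrable h (μ.singularPart ν).toJordanDecomposition.negPart ∧
    Integrable (fun ω => h ω * μ.rnDeriv ν ω) ν ∧
    ∫ᵛ ω, h ω ∂<•μ = ∫ ω, h ω * μ.rnDeriv ν ω ∂ν
      + ∫ ω, h ω ∂(μ.singularPart ν).toJordanDecomposition.posPart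
      - ∫ ω, h ω ∂(μ.singularPart ν).toJordanDecomposition.negPart := by
  have hh' := hh
  rw [← SignedMeasure.totalVariation_eq_variation, SignedMeasure.totalVariation,
    integrable_add_measure] at hh'
  obtain ⟨p1, p2, p3⟩ := integral_lebesgue_decomposition (ν := ν) hh'.1
  obtain ⟨n1, n2, n3⟩ := integral_lebesgue_decomposition (ν := ν) hh'.2
  rw [toJordanDecomposition_singularPart, integral_eq_posPart_sub_negPart hh, p3, n3]
  have e : (fun ω => h ω * μ.rnDeriv ν ω)
      = fun ω => h ω * (μ.toJordanDecomposition.posPart.rnDeriv ν ω).toReal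
        - h ω * (μ.toJordanDecomposition.negPart.rnDeriv ν ω).toReal := by
    ext ω; rw [SignedMeasure.rnDeriv_def, mul_sub]
  refine ⟨p1, n1, ?_, ?_⟩
  · rw [e]; exact p2.sub n2
  · rw [e, integral_sub p2 n2]; ring

theorem posPart_singularPart_le (μ : SignedMeasure Ω) (ν : Measure Ω) :
    (μ.singularPart ν).toJordanDecomposition.posPart ≤ μ.variation := by
  rw [toJordanDecomposition_singularPart, ← SignedMeasure.totalVariation_eq_variation]
  exact (Measure.singularPart_le _ _).trans (Measure.le_add_right le_rfl)

theorem negPart_singularPart_le (μ : SignedMeasure Ω) (ν : Measure Ω) :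
    (μ.singularPart ν).toJordanDecomposition.negPart ≤ μ.variation := by
  rw [toJordanDecomposition_singularPart, ← SignedMeasure.totalVariation_eq_variation]
  exact (Measure.singularPart_le _ _).trans (Measure.le_add_left le_rfl)

/-- Disjoint `ν`-null sets carrying the positive and the negative singular part. -/
theorem exists_null_sets_singularPart (μ : SignedMeasure Ω) (ν : Measure Ω) :
    ∃ A B : Set Ω, MeasurableSet A ∧ MeasurableSet B ∧ Disjoint A B ∧ ν A = 0 ∧ ν B = 0 ∧
      (μ.singularPart ν).toJordanDecomposition.posPart Aᶜ = 0 ∧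
      (μ.singularPart ν).toJordanDecomposition.negPart Bᶜ = 0 := by
  rw [toJordanDecomposition_singularPart]
  have h := SignedMeasure.singularPart_mutuallySingular μ ν
  obtain ⟨S, hS, hS1, hS2⟩ := (Measure.mutuallySingular_singularPart
    μ.toJordanDecomposition.posPart ν).add_right h
  obtain ⟨T, hT, hT1, hT2⟩ := (Measure.mutuallySingular_singularPart
    μ.toJordanDecomposition.negPart ν).add_right h.symm
  simp only [Measure.coe_add, Pi.add_apply, add_eq_zero] at hS2 hT2
  -- `Sᶜ` is null for the negative singular part as well as for `ν`, so removing it from `Tᶜ` gives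
  -- disjointness at no cost.
  refine ⟨Sᶜ, Tᶜ ∩ S, hS.compl, hT.compl.inter hS, ?_, hS2.1,
    measure_mono_null inter_subset_left hT2.1, by simpa using hS1, ?_⟩
  · exact disjoint_left.2 fun ω h1 h2 => h1 h2.2
  · rw [compl_inter, compl_compl]
    exact measure_union_null hT1 hS2.2

theorem lebesgue_decomposition_withDensityᵥ [IsFiniteMeasure ν] {k : Ω → ℝ} (hk : Integrable k ν) :
    SignedMeasure.singularPart (ν.withDensityᵥ k) ν = 0 ∧
      k =ᵐ[ν] SignedMeasure.rnDeriv (ν.withDensityᵥ k) ν ∧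
      (ν.withDensityᵥ k).variation ≪ ν := by
  have h0 : (0 : SignedMeasure Ω) ⟂ᵥ ν.toENNRealVectorMeasure := by
    exact VectorMeasure.MutuallySingular.zero_left
  refine ⟨(SignedMeasure.eq_singularPart _ k h0 (zero_add _).symm).symm,
    SignedMeasure.eq_rnDeriv _ k hk h0 (zero_add _).symm, ?_⟩
  rw [Measure.variation_withDensityᵥ hk]
  exact withDensity_absolutelyContinuous _ _

/-- An integral is at most the mass times an almost everywhere upper bound. -/
theorem integral_le_mass_mul {m : Measure Ω} [IsFiniteMeasure m] {h : Ω → ℝ} (hh : Integrable h m)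
    {σ : EReal} (hσ : σ ≠ ⊥) (hle : ∀ᵐ ω ∂m, (h ω : EReal) ≤ σ) :
    ((∫ ω, h ω ∂m : ℝ) : EReal) ≤ (m univ : EReal) * σ := by
  induction σ with
  | bot => exact absurd rfl hσ
  | top =>
    by_cases h0 : m = 0
    · simp [h0]
    · rw [EReal.mul_top_of_pos]
      · exact le_top
      · rw [← EReal.coe_ennreal_zero, EReal.coe_ennreal_lt_coe_ennreal_iff]
        exact pos_iff_ne_zero.2 (mt Measure.measure_univ_eq_zero.1 h0)
  | coe s =>
    have h1 : ∫ ω, h ω ∂m ≤ ∫ _, s ∂m := by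
      refine integral_mono_ae hh (integrable_const s) ?_
      filter_upwards [hle] with ω hω using EReal.coe_le_coe_iff.1 hω
    rw [integral_const, smul_eq_mul] at h1
    rw [← EReal.coe_ennreal_toReal (measure_ne_top m univ), ← EReal.coe_mul, EReal.coe_le_coe_iff]
    exact h1

/-! ### The essential range -/

variable {X : Submodule ℝ (SignedMeasure Ω)}

theorem essRange_subset_of_forall_mem {g : Ω → ℝ} {K : Set ℝ} (hK : IsClosed K)
    (hg : ∀ ω, g ω ∈ K) : essRange (nullIdeal X) g ⊆ K := by
  intro x hx
  rw [← hK.closure_eq, Metric.mem_closure_iff]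
  intro ε hε
  by_contra! hcon
  refine hx ε hε ?_
  have : g ⁻¹' Ioo (x - ε) (x + ε) = ∅ := by
    refine eq_empty_of_forall_notMem fun ω hω => ?_
    have h1 := hcon _ (hg ω)
    rw [Real.dist_eq] at h1
    have h2 : |x - g ω| < ε := abs_lt.2 ⟨by linarith [hω.2], by linarith [hω.1]⟩
    linarith
  rw [this]
  exact ⟨MeasurableSet.empty, fun μ _ => measure_empty⟩

/-- Every point outside the essential range has a neighbourhood with preimage in `Ξ`, and on the
line a locally null set is null for the image measure. -/
theorem ae_mem_essRange {h : Ω → ℝ} (hh : Measurable h) {μ : SignedMeasure Ω} (hμ : μ ∈ X) :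
    ∀ᵐ ω ∂μ.variation, h ω ∈ essRange (nullIdeal X) h := by
  have key : (μ.variation.map h) (essRange (nullIdeal X) h)ᶜ = 0 := by
    refine measure_null_of_locally_null _ fun x hx => ?_
    simp only [essRange, mem_compl_iff, mem_ofPred_eq, not_forall, not_not] at hx
    obtain ⟨ε, hε, hx⟩ := hx
    refine ⟨Ioo (x - ε) (x + ε), mem_nhdsWithin_of_mem_nhds
      (Ioo_mem_nhds (by linarith) (by linarith)), ?_⟩
    rw [Measure.map_apply hh measurableSet_Ioo]
    exact hx.2 μ hμ
  have h1 : ∀ᵐ x ∂μ.variation.map h, x ∈ essRange (nullIdeal X) h := mem_ae_iff.2 key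
  exact ae_of_ae_map hh.aemeasurable h1

theorem integralL0_add_smul {Y : Submodule ℝ (L0 X)} [IsFiniteMeasure ν] (hXY : IsDecomposable ν X Y)
    {f : MeasFun Ω} (hf : cls X f ∈ Y) (μ μ' : X) (t : ℝ) :
    integralL0 (μ + t • μ') (cls X f)
      = integralL0 μ (cls X f) + t * integralL0 μ' (cls X f) := by
  simp only [integralL0_cls, Submodule.coe_add, Submodule.coe_smul]
  rw [VectorMeasure.integral_add_vectorMeasure (hXY.integrable _ μ.2 f hf)
    (VectorMeasure.Integrable.smul_vectorMeasure (hXY.integrable _ μ'.2 f hf) t),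
    VectorMeasure.integral_smul_vectorMeasure, smul_eq_mul]

theorem exists_le_mul_of_lt_mul_iSup {p : ℝ} (hp : 0 ≤ p) {y : ℕ → ℝ} {r : EReal}
    (hr : r < (p : EReal) * ⨆ n, (y n : EReal)) : ∃ n, r ≤ ((p * y n : ℝ) : EReal) := by
  by_contra! hcon
  refine hr.not_ge ?_
  rcases hp.eq_or_lt with rfl | hp
  · have := hcon 0
    simp only [zero_mul, EReal.coe_zero] at this ⊢
    exact this.le
  · rw [mul_comm, ← EReal.le_div_iff_mul_le (EReal.coe_pos.2 hp) (EReal.coe_ne_top p)]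
    refine iSup_le fun n => ?_
    rw [EReal.le_div_iff_mul_le (EReal.coe_pos.2 hp) (EReal.coe_ne_top p), mul_comm,
      ← EReal.coe_mul]
    exact (hcon n).le

/-- The three terms of the divergence are approximated independently by real numbers, so that a
single test function has to be matched only with a real triple `c`, `i`, `j`. -/
theorem add_mul_iSup_sub_mul_iInf_le {A S : EReal} {p m : ℝ} (hp : 0 ≤ p) (hm : 0 ≤ m) {y : ℕ → ℝ}
    (h : ∀ c : ℝ, (c : EReal) < A → ∀ i j, ((c + p * y i - m * y j : ℝ) : EReal) ≤ S) :
    A + (p : EReal) * (⨆ n, (y n : EReal)) - (m : EReal) * (⨅ n, (y n : EReal)) ≤ S := by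
  rw [← neg_iSup_neg_coe, mul_neg, sub_eq_add_neg, neg_neg]
  refine EReal.add_le_of_forall_lt fun a' ha' b' hb' => ?_
  obtain ⟨j, hj⟩ := exists_le_mul_of_lt_mul_iSup hm hb'
  refine (add_le_add ha'.le hj).trans (EReal.add_le_of_le_sub ?_)
  refine EReal.add_le_of_forall_lt fun a' ha' b' hb' => ?_
  obtain ⟨i, hi⟩ := exists_le_mul_of_lt_mul_iSup hp hb'
  refine (add_le_add ha'.le hi).trans (EReal.add_le_of_le_sub ?_)
  refine EReal.ge_of_forall_gt_iff_ge.1 fun c hc => ?_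
  rw [EReal.le_sub_iff_add_le (Or.inl (EReal.coe_ne_bot _)) (Or.inl (EReal.coe_ne_top _)),
    EReal.le_sub_iff_add_le (Or.inl (EReal.coe_ne_bot _)) (Or.inl (EReal.coe_ne_top _)),
    ← EReal.coe_add, ← EReal.coe_add]
  refine le_trans (le_of_eq ?_) (h c hc i j)
  congr 1; ring

/-! ### First consequences of decomposability -/

variable [IsFiniteMeasure ν] {φ : ℝ → EReal} {Y : Submodule ℝ (L0 X)}

theorem IsDecomposable.cls_mem_of_bounded (hXY : IsDecomposable ν X Y) {g : MeasFun Ω} {C : ℝ}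
    (hC : ∀ ω, |(g : Ω → ℝ) ω| ≤ C) : cls X g ∈ Y :=
  hXY.bounded_mem g ((Metric.isBounded_Icc (-C) C).subset
    (essRange_subset_of_forall_mem isClosed_Icc fun ω => abs_le.1 (hC ω)))

theorem IsDecomposable.integrable_base (hXY : IsDecomposable ν X Y) {g : MeasFun Ω}
    (hg : cls X g ∈ Y) : Integrable (g : Ω → ℝ) ν := by
  have := hXY.integrable _ hXY.mem g hg
  rwa [Measure.variation_toSignedMeasure] at this

theorem essRangeInSlopes_of_forall_mem {g : Ω → ℝ}
    (hg : ∀ ω, (g ω : EReal) ∈ Icc (slopeBot φ) (slopeTop φ)) :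
    EssRangeInSlopes φ (nullIdeal X) g :=
  essRange_subset_of_forall_mem (K := ((↑) : ℝ → EReal) ⁻¹' Icc (slopeBot φ) (slopeTop φ))
    (isClosed_Icc.preimage continuous_coe_real_ereal) hg

theorem slopeTop_ne_bot (hφ : IsDivergenceFunction φ) : slopeTop φ ≠ ⊥ := by
  obtain ⟨y, b, -, hF⟩ := hφ.exists_seq_eq_iSup
  rw [slopeTop_eq_iSup hφ hF]
  exact ne_bot_of_le_ne_bot (EReal.coe_ne_bot (y 0)) (le_iSup (fun n => (y n : EReal)) 0)

theorem slopeBot_ne_top (hφ : IsDivergenceFunction φ) : slopeBot φ ≠ ⊤ := by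
  obtain ⟨y, b, -, hF⟩ := hφ.exists_seq_eq_iSup
  rw [slopeBot_eq_iInf hφ hF]
  exact ne_top_of_le_ne_top (EReal.coe_ne_top (y 0)) (iInf_le (fun n => (y n : EReal)) 0)

theorem measurable_realConjugate (hφ : IsDivergenceFunction φ) : Measurable (realConjugate φ) := by
  obtain ⟨x, c, -, hF⟩ := hφ.exists_seq_realConjugate_eq_iSup
  exact measurable_of_eq_iSup hF

theorem IsDivergenceFunction.measurable (hφ : IsDivergenceFunction φ) : Measurable φ :=
  hφ.lsc.measurable

/-- The functions over which the variational formula for the divergence takes the supremum. -/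
def admissible (φ : ℝ → EReal) (X : Submodule ℝ (SignedMeasure Ω)) (Y : Submodule ℝ (L0 X)) :
    Set (MeasFun Ω) :=
  {g : MeasFun Ω | cls X g ∈ Y ∧ EssRangeInSlopes φ (nullIdeal X) (g : Ω → ℝ)}

/-! ### The variational formula -/

/-- The test function `g = y ∘ κ'` has finitely many values, all between the slopes, and `φ* ∘ g = b
∘ κ'` is integrable. It handles the three parts of `μ` at once. -/
theorem divergence_le_iSup (hφ : IsDivergenceFunction φ) (hXY : IsDecomposable ν X Y) (μ : X) :
    divergence φ ν (μ : SignedMeasure Ω) ≤ ⨆ g ∈ admissible φ X Y,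
      ((integralL0 μ (cls X g) : ℝ) : EReal)
        - extIntegral ν (fun ω => realConjugate φ ((g : Ω → ℝ) ω)) := by
  obtain ⟨y, b, hb, hF⟩ := hφ.exists_seq_eq_iSup
  obtain ⟨A, B, hA, hB, hAB, hνA, hνB, hpA, hnB⟩ :=
    exists_null_sets_singularPart (μ : SignedMeasure Ω) ν
  rw [divergence, slopeTop_eq_iSup hφ hF, slopeBot_eq_iInf hφ hF,
    ← EReal.coe_ennreal_toReal (measure_ne_top _ univ),
    ← EReal.coe_ennreal_toReal (measure_ne_top _ univ)]
  refine add_mul_iSup_sub_mul_iInf_le ENNReal.toReal_nonneg ENNReal.toReal_nonneg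
    fun c hc i j => ?_
  obtain ⟨κ, hκ, ⟨N, hN⟩, hlt⟩ := exists_index_lt_integral hF
    (SignedMeasure.measurable_rnDeriv _ _) (SignedMeasure.integrable_rnDeriv _ _) hc
  classical
  -- `ν` does not see the change on `A` and `B`, while the positive and negative singular parts see
  -- only the constants `y i` and `y j`.
  set κ' : Ω → ℕ := fun ω => if ω ∈ A then i else if ω ∈ B then j else κ ω with hκ'
  have hκ'm : Measurable κ' :=
    Measurable.ite hA measurable_const (Measurable.ite hB measurable_const hκ)
  have hκ'N : ∀ ω, κ' ω ≤ i + j + N := fun ω => by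
    have := hN ω
    simp only [hκ']
    split_ifs <;> omega
  have hκκ' : κ' =ᵐ[ν] κ := by
    filter_upwards [measure_eq_zero_iff_ae_notMem.1 hνA, measure_eq_zero_iff_ae_notMem.1 hνB]
      with ω h1 h2
    simp [hκ', h1, h2]
  let g : MeasFun Ω := ⟨fun ω => y (κ' ω), (measurable_of_countable y).comp hκ'm⟩
  have hg : ∀ ω, (g : Ω → ℝ) ω = y (κ' ω) := fun ω => rfl
  have hgY : cls X g ∈ Y := hXY.cls_mem_of_bounded
    (C := ∑ n ∈ Finset.range (i + j + N + 1), |y n|) fun ω =>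
      Finset.single_le_sum (f := fun n => |y n|) (fun _ _ => abs_nonneg _)
        (Finset.mem_range.2 (Nat.lt_succ_of_le (hκ'N ω)))
  have hgS : EssRangeInSlopes φ (nullIdeal X) (g : Ω → ℝ) := by
    refine essRangeInSlopes_of_forall_mem fun ω => ?_
    rw [slopeTop_eq_iSup hφ hF, slopeBot_eq_iInf hφ hF]
    exact ⟨iInf_le (fun n => (y n : EReal)) _, le_iSup (fun n => (y n : EReal)) _⟩
  refine le_iSup₂_of_le g ⟨hgY, hgS⟩ ?_
  have hbκ := (integrable_mul_comp_sub_comp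
    (SignedMeasure.integrable_rnDeriv (μ : SignedMeasure Ω) ν) y b hκ hN)
  have hbκ' := (integrable_mul_comp_sub_comp
    (SignedMeasure.integrable_rnDeriv (μ : SignedMeasure Ω) ν) y b hκ'm hκ'N).2
  have e1 : extIntegral ν (fun ω => realConjugate φ ((g : Ω → ℝ) ω))
      = ((∫ ω, b (κ ω) ∂ν : ℝ) : EReal) := by
    simp only [hg, hb]
    rw [extIntegral_coe hbκ']
    congr 1
    refine integral_congr_ae ?_
    filter_upwards [hκκ'] with ω hω using by rw [hω]
  obtain ⟨-, -, -, e2⟩ := integral_lebesgue_jordan (ν := ν) (hXY.integrable _ μ.2 g hgY)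
  have e3 : ∫ ω, (g : Ω → ℝ) ω * SignedMeasure.rnDeriv (μ : SignedMeasure Ω) ν ω ∂ν
      = ∫ ω, SignedMeasure.rnDeriv (μ : SignedMeasure Ω) ν ω * y (κ ω) ∂ν := by
    refine integral_congr_ae ?_
    filter_upwards [hκκ'] with ω hω using by rw [hg, hω, mul_comm]
  have e4 : ∫ ω, (g : Ω → ℝ) ω ∂(SignedMeasure.singularPart (μ : SignedMeasure Ω)
        ν).toJordanDecomposition.posPart
      = ((SignedMeasure.singularPart (μ : SignedMeasure Ω)
        ν).toJordanDecomposition.posPart univ).toReal * y i := by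
    have : (g : Ω → ℝ) =ᵐ[(SignedMeasure.singularPart (μ : SignedMeasure Ω)
        ν).toJordanDecomposition.posPart] fun _ => y i := by
      filter_upwards [measure_eq_zero_iff_ae_notMem.1 hpA] with ω hω
      simp [hg, hκ', not_not.1 hω]
    rw [integral_congr_ae this, integral_const, smul_eq_mul]
    rfl
  have e5 : ∫ ω, (g : Ω → ℝ) ω ∂(SignedMeasure.singularPart (μ : SignedMeasure Ω)
        ν).toJordanDecomposition.negPart
      = ((SignedMeasure.singularPart (μ : SignedMeasure Ω)
        ν).toJordanDecomposition.negPart univ).toReal * y j := by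
    have : (g : Ω → ℝ) =ᵐ[(SignedMeasure.singularPart (μ : SignedMeasure Ω)
        ν).toJordanDecomposition.negPart] fun _ => y j := by
      filter_upwards [measure_eq_zero_iff_ae_notMem.1 hnB] with ω hω
      have hωB : ω ∈ B := not_not.1 hω
      simp [hg, hκ', hωB, disjoint_right.1 hAB hωB]
    rw [integral_congr_ae this, integral_const, smul_eq_mul]
    rfl
  rw [integralL0_cls, e1, e2, e3, e4, e5, ← EReal.coe_sub, EReal.coe_le_coe_iff]
  rw [integral_sub hbκ.1 hbκ.2] at hlt
  linarith

/-- One line below `φ` bounds all three terms from below. This permits moving `D` across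
inequalities in `EReal`. -/
theorem divergence_ne_bot (hφ : IsDivergenceFunction φ) (ν : Measure Ω) [IsFiniteMeasure ν]
    (μ : SignedMeasure Ω) : divergence φ ν μ ≠ ⊥ := by
  obtain ⟨y, b, hb, hF⟩ := hφ.exists_seq_eq_iSup
  have h1 : extIntegral ν (fun ω => φ (μ.rnDeriv ν ω)) ≠ ⊥ :=
    extIntegral_ne_bot (u := fun ω => μ.rnDeriv ν ω * y 0 - b 0)
      (((SignedMeasure.integrable_rnDeriv μ ν).mul_const _).sub (integrable_const _))
      (ae_of_all _ fun ω => by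
        rw [hF]; exact le_iSup (fun n => ((μ.rnDeriv ν ω * y n - b n : ℝ) : EReal)) 0)
  have h2 : ((μ.singularPart ν).toJordanDecomposition.posPart univ : EReal) * slopeTop φ ≠ ⊥ := by
    have := integral_le_mass_mul (m := (μ.singularPart ν).toJordanDecomposition.posPart)
      (h := fun _ => y 0) (integrable_const _) (slopeTop_ne_bot hφ) (ae_of_all _ fun _ => by
        rw [slopeTop_eq_iSup hφ hF]; exact le_iSup (fun n => (y n : EReal)) 0)
    exact ne_bot_of_le_ne_bot (EReal.coe_ne_bot _) this
  have h3 : ((μ.singularPart ν).toJordanDecomposition.negPart univ : EReal) * (-slopeBot φ) ≠ ⊥ := by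
    have := integral_le_mass_mul (m := (μ.singularPart ν).toJordanDecomposition.negPart)
      (h := fun _ => -y 0) (integrable_const _) (mt EReal.neg_eq_bot_iff.1 (slopeBot_ne_top hφ))
      (ae_of_all _ fun _ => by
        rw [slopeBot_eq_iInf hφ hF, EReal.coe_neg, EReal.neg_le_neg_iff]
        exact iInf_le (fun n => (y n : EReal)) 0)
    exact ne_bot_of_le_ne_bot (EReal.coe_ne_bot _) this
  rw [divergence, sub_eq_add_neg, ← mul_neg]
  simp only [ne_eq, EReal.add_eq_bot_iff, not_or]
  exact ⟨⟨h1, h2⟩, h3⟩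

/-- The integrated Fenchel-Young inequality. -/
theorem integralL0_le_divergence_add (hφ : IsDivergenceFunction φ) (hXY : IsDecomposable ν X Y)
    (μ : X) {g : MeasFun Ω} (hg : g ∈ admissible φ X Y) :
    ((integralL0 μ (cls X g) : ℝ) : EReal) ≤ divergence φ ν (μ : SignedMeasure Ω)
      + extIntegral ν (fun ω => realConjugate φ ((g : Ω → ℝ) ω)) := by
  obtain ⟨y, b, hb, hF⟩ := hφ.exists_seq_eq_iSup
  have hgm : Measurable (g : Ω → ℝ) := measurable_measFun g
  obtain ⟨i1, i2, i3, e⟩ := integral_lebesgue_jordan (ν := ν) (hXY.integrable _ μ.2 g hg.1)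
  have hfm := SignedMeasure.measurable_rnDeriv (μ : SignedMeasure Ω) ν
  have hfi := SignedMeasure.integrable_rnDeriv (μ : SignedMeasure Ω) ν
  have h1 := integral_le_extIntegral_add (ν := ν)
    (F := fun ω => φ (SignedMeasure.rnDeriv (μ : SignedMeasure Ω) ν ω))
    (G := fun ω => realConjugate φ ((g : Ω → ℝ) ω))
    (u := fun ω => SignedMeasure.rnDeriv (μ : SignedMeasure Ω) ν ω * y 0 - b 0)
    (hφ.measurable.comp hfm) ((measurable_realConjugate hφ).comp hgm)
    ((hfi.mul_const _).sub (integrable_const _)) (hXY.integrable_base hg.1) i3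
    (ae_of_all _ fun ω => by
      rw [hF]; exact le_iSup (fun n => ((SignedMeasure.rnDeriv (μ : SignedMeasure Ω) ν ω * y n
        - b n : ℝ) : EReal)) 0)
    (ae_of_all _ fun ω => hφ.le_realConjugate _)
    (ae_of_all _ fun ω => by rw [mul_comm]; exact hφ.young _ _)
  -- The slope condition passes from `Ξ` to the variation of `μ`, and from there to the singular
  -- parts, which it dominates.
  have hae : ∀ᵐ ω ∂(μ : SignedMeasure Ω).variation,
      ((g : Ω → ℝ) ω : EReal) ∈ Icc (slopeBot φ) (slopeTop φ) :=
    (ae_mem_essRange hgm μ.2).mono fun ω hω => hg.2 _ hω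
  have h2 := integral_le_mass_mul i1 (slopeTop_ne_bot hφ)
    ((hae.filter_mono (ae_mono (posPart_singularPart_le (μ : SignedMeasure Ω) ν))).mono
      fun ω hω => hω.2)
  have h3 := integral_le_mass_mul i2.neg (mt EReal.neg_eq_bot_iff.1 (slopeBot_ne_top hφ))
    ((hae.filter_mono (ae_mono (negPart_singularPart_le (μ : SignedMeasure Ω) ν))).mono
      fun ω hω => by
        rw [Pi.neg_apply, EReal.coe_neg, EReal.neg_le_neg_iff]; exact hω.1)
  rw [integralL0_cls, e, divergence, sub_eq_add_neg, sub_eq_add_neg, ← mul_neg, EReal.coe_add,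
    EReal.coe_add, add_right_comm (_ + _), add_right_comm (extIntegral _ _)]
  simp only [Pi.neg_apply, integral_neg] at h3
  exact add_le_add (add_le_add h1 h2) h3

theorem divergence_eq_iSup (hφ : IsDivergenceFunction φ) (hXY : IsDecomposable ν X Y) (μ : X) :
    divergence φ ν (μ : SignedMeasure Ω) = ⨆ g ∈ admissible φ X Y,
      ((integralL0 μ (cls X g) : ℝ) : EReal)
        - extIntegral ν (fun ω => realConjugate φ ((g : Ω → ℝ) ω)) :=
  (divergence_le_iSup hφ hXY μ).antisymm (iSup₂_le fun _ hg =>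
    EReal.sub_le_of_le_add (integralL0_le_divergence_add hφ hXY μ hg))

/-! ### The conjugate -/

/-- The test measure has density `x ∘ κ`: it is bounded, hence in `X`, and has no singular part, so
its divergence is `∫ c ∘ κ dν`. -/
theorem extIntegral_le_conjugate (hφ : IsDivergenceFunction φ) (hXY : IsDecomposable ν X Y)
    {h : MeasFun Ω} (hY : cls X h ∈ Y) :
    extIntegral ν (fun ω => realConjugate φ ((h : Ω → ℝ) ω))
      ≤ conjugate (pairing X Y) (divergenceOn φ ν X) ⟨cls X h, hY⟩ := by
  obtain ⟨x, c, hc, hF⟩ := hφ.exists_seq_realConjugate_eq_iSup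
  refine EReal.ge_of_forall_gt_iff_ge.1 fun r hr => ?_
  obtain ⟨κ, hκ, ⟨N, hN⟩, hlt⟩ := exists_index_lt_integral hF (measurable_measFun h)
    (hXY.integrable_base hY) hr
  obtain ⟨i1, i2⟩ := integrable_mul_comp_sub_comp (hXY.integrable_base hY) x c hκ hN
  have ix : Integrable (fun ω => x (κ ω)) ν :=
    (integrable_mul_comp_sub_comp (hXY.integrable_base hY) x x hκ hN).2
  obtain ⟨hs, hd, hac⟩ := lebesgue_decomposition_withDensityᵥ ix
  have hmem : ν.withDensityᵥ (fun ω => x (κ ω)) ∈ X := by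
    refine hXY.bounded_density_mem _ hac ((memLp_congr_ae hd).1 ?_)
    refine memLp_top_of_bound ix.aestronglyMeasurable (∑ n ∈ Finset.range (N + 1), ‖x n‖)
      (ae_of_all _ fun ω => ?_)
    exact Finset.single_le_sum (f := fun n => ‖x n‖) (fun _ _ => norm_nonneg _)
      (Finset.mem_range.2 (Nat.lt_succ_of_le (hN ω)))
  refine le_iSup_of_le ⟨_, hmem⟩ ?_
  have e1 : divergence φ ν (ν.withDensityᵥ fun ω => x (κ ω)) = ((∫ ω, c (κ ω) ∂ν : ℝ) : EReal) := by
    have : (fun ω => φ (SignedMeasure.rnDeriv (ν.withDensityᵥ fun ω => x (κ ω)) ν ω))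
        =ᵐ[ν] fun ω => ((c (κ ω) : ℝ) : EReal) := by
      filter_upwards [hd] with ω hω
      rw [← hω, hc]
    rw [divergence, hs, extIntegral_congr_ae this, extIntegral_coe i2,
      SignedMeasure.toJordanDecomposition_zero, JordanDecomposition.zero_posPart,
      JordanDecomposition.zero_negPart]
    simp
  obtain ⟨-, -, -, e2⟩ := integral_lebesgue_jordan (ν := ν) (hXY.integrable _ hmem h hY)
  have e3 : ∫ ω, (h : Ω → ℝ) ω * SignedMeasure.rnDeriv (ν.withDensityᵥ fun ω => x (κ ω)) ν ω ∂ν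
      = ∫ ω, (h : Ω → ℝ) ω * x (κ ω) ∂ν := by
    refine integral_congr_ae ?_
    filter_upwards [hd] with ω hω
    rw [← hω]
  rw [hs, e3, SignedMeasure.toJordanDecomposition_zero, JordanDecomposition.zero_posPart,
    JordanDecomposition.zero_negPart, integral_zero_measure, add_zero, sub_zero] at e2
  rw [pairing, divergenceOn, integralL0_cls, e1, e2, ← EReal.coe_sub, EReal.coe_le_coe_iff]
  rw [integral_sub i1 i2] at hlt
  exact hlt.le

theorem conjugate_le_extIntegral (hφ : IsDivergenceFunction φ) (hXY : IsDecomposable ν X Y)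
    {h : MeasFun Ω} (hY : cls X h ∈ Y) (hS : EssRangeInSlopes φ (nullIdeal X) (h : Ω → ℝ)) :
    conjugate (pairing X Y) (divergenceOn φ ν X) ⟨cls X h, hY⟩
      ≤ extIntegral ν (fun ω => realConjugate φ ((h : Ω → ℝ) ω)) :=
  iSup_le fun μ => EReal.sub_le_of_le_add' (integralL0_le_divergence_add hφ hXY μ ⟨hY, hS⟩)

/-- Along the ray `ν + t • μ` the variational formula gives `D ≤ t * r`, because `∫ g dν ≤ ∫ φ* ∘ g
dν`. The pairing with `h` is at least `∫ h dν + t * s`, so the difference is unbounded as `t` grows.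
-/
theorem conjugate_eq_top_of_separated (hφ : IsDivergenceFunction φ) (hXY : IsDecomposable ν X Y)
    {h : MeasFun Ω} (hY : cls X h ∈ Y) (μ : X) {r s : ℝ} (hrs : r < s)
    (hr : ∀ g ∈ admissible φ X Y, integralL0 μ (cls X g) ≤ r) (hs : s ≤ integralL0 μ (cls X h)) :
    conjugate (pairing X Y) (divergenceOn φ ν X) ⟨cls X h, hY⟩ = ⊤ := by
  refine EReal.eq_top_iff_forall_lt _ |>.2 fun z => ?_
  obtain ⟨t, ht⟩ := exists_nat_gt ((z - ∫ ω, (h : Ω → ℝ) ω ∂ν) / (s - r))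
  rw [div_lt_iff₀ (by linarith)] at ht
  have hint : ∀ g : MeasFun Ω, integralL0 (⟨_, hXY.mem⟩ : X) (cls X g) = ∫ ω, (g : Ω → ℝ) ω ∂ν :=
    fun g => by rw [integralL0_cls]; exact VectorMeasure.integral_toSignedMeasure
  have hD : divergence φ ν ((⟨_, hXY.mem⟩ + (t : ℝ) • μ : X) : SignedMeasure Ω)
      ≤ ((t * r : ℝ) : EReal) := by
    rw [divergence_eq_iSup hφ hXY]
    refine iSup₂_le fun g hg => EReal.sub_le_of_le_add ?_
    rw [integralL0_add_smul hXY hg.1, hint, add_comm, EReal.coe_add]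
    refine add_le_add ?_ ?_
    · exact EReal.coe_le_coe_iff.2 (mul_le_mul_of_nonneg_left (hr g hg) t.cast_nonneg)
    · rw [← extIntegral_coe (hXY.integrable_base hg.1)]
      exact extIntegral_mono_ae (ae_of_all _ fun ω => hφ.le_realConjugate _)
  refine lt_of_lt_of_le ?_ (le_iSup _ (⟨_, hXY.mem⟩ + (t : ℝ) • μ : X))
  refine lt_of_lt_of_le ?_ (EReal.sub_le_sub le_rfl hD)
  rw [pairing, integralL0_add_smul hXY hY, hint, ← EReal.coe_sub, EReal.coe_lt_coe_iff]
  have := mul_le_mul_of_nonneg_left hs (t.cast_nonneg : (0 : ℝ) ≤ t)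
  linarith

theorem conjugate_eq_top (hφ : IsDivergenceFunction φ) (hXY : IsDecomposable ν X Y)
    {h : MeasFun Ω} (hY : cls X h ∈ Y) (hS : ¬ EssRangeInSlopes φ (nullIdeal X) (h : Ω → ℝ)) :
    conjugate (pairing X Y) (divergenceOn φ ν X) ⟨cls X h, hY⟩ = ⊤ := by
  have hhm : Measurable (h : Ω → ℝ) := measurable_measFun h
  simp only [EssRangeInSlopes, not_forall] at hS
  obtain ⟨x, hx, hxS⟩ := hS
  have carried : ∀ ε > 0, ∃ m : Measure Ω, ∃ _ : IsFiniteMeasure m, m.toSignedMeasure ∈ X ∧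
      0 < m.real univ ∧ ∀ᵐ ω ∂m, (h : Ω → ℝ) ω ∈ Ioo (x - ε) (x + ε) := by
    intro ε hε
    have hm : MeasurableSet ((h : Ω → ℝ) ⁻¹' Ioo (x - ε) (x + ε)) := hhm measurableSet_Ioo
    obtain ⟨μ, hμ, h0, hne, hc⟩ := hXY.exists_carried _ hm (hx ε hε)
    have hle : 0 ≤[univ] μ := by rwa [VectorMeasure.le_restrict_univ_iff_le]
    set m := μ.toMeasureOfZeroLE univ MeasurableSet.univ hle with hmdef
    have hmμ : m.toSignedMeasure = μ := SignedMeasure.toMeasureOfZeroLE_toSignedMeasure μ hle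
    refine ⟨m, inferInstance, by rw [hmμ]; exact hμ, ?_, ?_⟩
    · refine lt_of_le_of_ne measureReal_nonneg fun h00 => hne ?_
      have : m = 0 := by
        rw [← Measure.measure_univ_eq_zero]
        exact (measureReal_eq_zero_iff).1 h00.symm
      rw [← hmμ]
      ext s hs
      simp [this]
    · rw [ae_iff]
      rw [← hmμ, Measure.toSignedMeasure_apply_measurable hm.compl] at hc
      exact (measureReal_eq_zero_iff).1 hc
  have bounds : ∀ m : Measure Ω, ∀ _ : IsFiniteMeasure m, ∀ hmX : m.toSignedMeasure ∈ X,
      ∀ g ∈ admissible φ X Y, Integrable (g : Ω → ℝ) m ∧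
        ∀ᵐ ω ∂m, ((g : Ω → ℝ) ω : EReal) ∈ Icc (slopeBot φ) (slopeTop φ) := by
    intro m _ hmX g hg
    have h1 := hXY.integrable _ hmX g hg.1
    have h2 := (ae_mem_essRange (measurable_measFun g) hmX).mono fun ω hω => hg.2 _ hω
    rw [Measure.variation_toSignedMeasure] at h1 h2
    exact ⟨h1, h2⟩
  have const_int : ∀ (m : Measure Ω) (r : ℝ), ∫ _, r ∂m = m.real univ * r := fun m r => by
    rw [integral_const, smul_eq_mul]
  rw [mem_Icc, not_and_or, not_le, not_le] at hxS
  rcases hxS with hxS | hxS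
  · obtain ⟨s, hs1, hs2⟩ := EReal.lt_iff_exists_real_btwn.1 hxS
    rw [EReal.coe_lt_coe_iff] at hs1
    obtain ⟨r, hr1, hr2⟩ := exists_between hs1
    -- Here `x < r < s < φ'(-∞)`. With this radius `h < r` almost everywhere for `m`, while
    -- admissible functions exceed `s`; the separating measure is `-m`.
    obtain ⟨m, hmf, hmX, hm0, hmae⟩ := carried (r - x) (by linarith)
    have neg_int : ∀ g : MeasFun Ω, integralL0 (-⟨_, hmX⟩ : X) (cls X g)
        = -∫ ω, (g : Ω → ℝ) ω ∂m := fun g => by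
      rw [integralL0_cls, Submodule.coe_neg, VectorMeasure.integral_neg_vectorMeasure]
      exact congrArg _ VectorMeasure.integral_toSignedMeasure
    refine conjugate_eq_top_of_separated hφ hXY hY (-⟨_, hmX⟩ : X)
      (r := -(m.real univ * s)) (s := -(m.real univ * r)) ?_ (fun g hg => ?_) ?_
    · exact neg_lt_neg (mul_lt_mul_of_pos_left hr2 hm0)
    · obtain ⟨h1, h2⟩ := bounds m hmf hmX g hg
      rw [neg_int, neg_le_neg_iff, ← const_int]
      refine integral_mono_ae (integrable_const s) h1 (h2.mono fun ω hω => ?_)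
      exact EReal.coe_le_coe_iff.1 (hs2.le.trans hω.1)
    · rw [neg_int, neg_le_neg_iff, ← const_int]
      have h1 := hXY.integrable _ hmX h hY
      rw [Measure.variation_toSignedMeasure] at h1
      refine integral_mono_ae h1 (integrable_const r) (hmae.mono fun ω hω => ?_)
      simpa using hω.2.le
  · obtain ⟨s, hs1, hs2⟩ := EReal.lt_iff_exists_real_btwn.1 hxS
    rw [EReal.coe_lt_coe_iff] at hs2
    obtain ⟨r, hr1, hr2⟩ := exists_between hs2
    -- Mirror case `φ'(∞) < s < r < x`, where `m` itself separates.
    obtain ⟨m, hmf, hmX, hm0, hmae⟩ := carried (x - r) (by linarith)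
    have pos_int : ∀ g : MeasFun Ω, integralL0 (⟨_, hmX⟩ : X) (cls X g)
        = ∫ ω, (g : Ω → ℝ) ω ∂m := fun g => by
      rw [integralL0_cls]
      exact VectorMeasure.integral_toSignedMeasure
    refine conjugate_eq_top_of_separated hφ hXY hY (⟨_, hmX⟩ : X)
      (r := m.real univ * s) (s := m.real univ * r) ?_ (fun g hg => ?_) ?_
    · exact mul_lt_mul_of_pos_left hr1 hm0
    · obtain ⟨h1, h2⟩ := bounds m hmf hmX g hg
      rw [pos_int, ← const_int]
      refine integral_mono_ae h1 (integrable_const s) (h2.mono fun ω hω => ?_)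
      exact EReal.coe_le_coe_iff.1 (hω.2.trans hs1.le)
    · rw [pos_int, ← const_int]
      have h1 := hXY.integrable _ hmX h hY
      rw [Measure.variation_toSignedMeasure] at h1
      refine integral_mono_ae (integrable_const r) h1 (hmae.mono fun ω hω => ?_)
      simpa using hω.1.le

/-! ### Semicontinuity and biconjugate -/

/-- The constant will be `∫ φ* ∘ g dν`, possibly infinite; the map is then constant. -/
theorem continuous_coe_sub_const (c : EReal) : Continuous fun x : ℝ => (x : EReal) - c := by
  induction c with
  | bot => simpa using continuous_const
  | top => simpa using continuous_const
  | coe c =>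
    simp only [← EReal.coe_sub]
    exact continuous_coe_real_ereal.comp (continuous_id.sub continuous_const)

theorem lowerSemicontinuous_divergenceOn (hφ : IsDivergenceFunction φ)
    (hXY : IsDecomposable ν X Y) (τ : TopologicalSpace X)
    (hτ : ∀ h : Y, Continuous fun μ : X => pairing X Y μ h) :
    LowerSemicontinuous (divergenceOn φ ν X) := by
  have : divergenceOn φ ν X = fun μ : X => ⨆ g ∈ admissible φ X Y,
      ((integralL0 μ (cls X g) : ℝ) : EReal)
        - extIntegral ν (fun ω => realConjugate φ ((g : Ω → ℝ) ω)) :=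
    funext fun μ => divergence_eq_iSup hφ hXY μ
  rw [this]
  exact lowerSemicontinuous_biSup fun g hg =>
    ((continuous_coe_sub_const _).comp (hτ ⟨cls X g, hg.1⟩)).lowerSemicontinuous

theorem IsCompatible.continuous_pairing (hXY : IsDecomposable ν X Y)
    {τ : TopologicalSpace X} (hτ : IsCompatible X Y τ) (h : Y) :
    Continuous fun μ : X => pairing X Y μ h := by
  obtain ⟨⟨f, hf⟩⟩ : Nonempty {f : MeasFun Ω // cls X f = (h : L0 X)} := by
    obtain ⟨f, hf⟩ := Submodule.Quotient.mk_surjective _ (h : L0 X)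
    exact ⟨⟨f, hf⟩⟩
  have hfY : cls X f ∈ Y := hf ▸ h.2
  let l : X →ₗ[ℝ] ℝ :=
    { toFun := fun μ => pairing X Y μ h
      map_add' := fun μ μ' => by
        have := integralL0_add_smul hXY hfY μ μ' 1
        simpa [pairing, ← hf] using this
      map_smul' := fun t μ => by
        -- Additivity at `0 + 0` shows that the pairing vanishes at the zero measure, as homogeneity
        -- requires.
        have h0 := integralL0_add_smul hXY hfY 0 0 1
        have := integralL0_add_smul hXY hfY 0 μ t
        simp only [one_smul, add_zero, one_mul, zero_add, left_eq_add] at h0 this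
        simpa [pairing, ← hf, h0] using this }
  exact (hτ.dual l).2 ⟨h, fun μ => rfl⟩

/-- The inequality `D ≤ D**` is the variational formula combined with `D*(g) ≤ ∫ φ* ∘ g dν` on
admissible `g`. The reverse is formal once `D` and `D*` are known to avoid `⊥`. -/
theorem divergence_eq_biconjugate (hφ : IsDivergenceFunction φ) (hXY : IsDecomposable ν X Y)
    (μ : X) : divergence φ ν (μ : SignedMeasure Ω)
      = conjugate (fun (h : Y) (μ' : X) => pairing X Y μ' h)
          (conjugate (pairing X Y) (divergenceOn φ ν X)) μ := by
  refine le_antisymm ?_ (iSup_le fun h => ?_)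
  · rw [divergence_eq_iSup hφ hXY]
    refine iSup₂_le fun g hg => le_iSup_of_le (⟨cls X g, hg.1⟩ : Y) ?_
    exact EReal.sub_le_sub le_rfl (conjugate_le_extIntegral hφ hXY hg.1 hg.2)
  · refine EReal.sub_le_of_le_add ?_
    have h1 : ((pairing X Y μ h : ℝ) : EReal) - divergence φ ν (μ : SignedMeasure Ω)
        ≤ conjugate (pairing X Y) (divergenceOn φ ν X) h :=
      le_iSup (fun μ : X => ((pairing X Y μ h : ℝ) : EReal) - divergenceOn φ ν X μ) μ
    have h2 : conjugate (pairing X Y) (divergenceOn φ ν X) h ≠ ⊥ := by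
      obtain ⟨f, hf⟩ := Submodule.Quotient.mk_surjective _ (h : L0 X)
      have hfY : cls X f ∈ Y := by rw [cls, hf]; exact h.2
      have e : h = ⟨cls X f, hfY⟩ := Subtype.ext hf.symm
      rw [e]
      refine ne_bot_of_le_ne_bot ?_ (extIntegral_le_conjugate hφ hXY hfY)
      exact extIntegral_ne_bot (hXY.integrable_base hfY)
        (ae_of_all _ fun ω => hφ.le_realConjugate _)
    rw [EReal.sub_le_iff_le_add (Or.inl (divergence_ne_bot hφ ν μ)) (Or.inr h2)] at h1
    rw [add_comm]
    exact h1

end PhiDiv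

theorem mainTheorem2 {Ω : Type*} [MeasurableSpace Ω]
    (φ : ℝ → EReal) (hφ : PhiDiv.IsDivergenceFunction φ)
    (ν : MeasureTheory.Measure Ω) [MeasureTheory.IsFiniteMeasure ν]
    (X : Submodule ℝ (MeasureTheory.SignedMeasure Ω)) (Y : Submodule ℝ (PhiDiv.L0 X))
    (hXY : PhiDiv.IsDecomposable ν X Y) :
    -- the conjugate of the divergence over `X`
    (∀ (h : PhiDiv.MeasFun Ω) (hY : PhiDiv.cls X h ∈ Y),
      (PhiDiv.EssRangeInSlopes φ (PhiDiv.nullIdeal X) (h : Ω → ℝ) →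
        PhiDiv.conjugate (PhiDiv.pairing X Y) (PhiDiv.divergenceOn φ ν X) ⟨PhiDiv.cls X h, hY⟩
          = PhiDiv.extIntegral ν (fun ω => PhiDiv.realConjugate φ ((h : Ω → ℝ) ω))) ∧
      (¬ PhiDiv.EssRangeInSlopes φ (PhiDiv.nullIdeal X) (h : Ω → ℝ) →
        PhiDiv.conjugate (PhiDiv.pairing X Y) (PhiDiv.divergenceOn φ ν X) ⟨PhiDiv.cls X h, hY⟩
          = ⊤)) ∧
    -- lower semicontinuity, for the weak topology and for every compatible topology
    @LowerSemicontinuous X EReal (PhiDiv.weakTopology X Y) _ (PhiDiv.divergenceOn φ ν X) ∧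
    (∀ τ : TopologicalSpace X, PhiDiv.IsCompatible X Y τ →
      @LowerSemicontinuous X EReal τ _ (PhiDiv.divergenceOn φ ν X)) ∧
    -- the divergence is its own biconjugate
    (∀ μ : X, PhiDiv.divergence φ ν (μ : MeasureTheory.SignedMeasure Ω)
      = PhiDiv.conjugate (fun (h : Y) (μ' : X) => PhiDiv.pairing X Y μ' h)
          (PhiDiv.conjugate (PhiDiv.pairing X Y) (PhiDiv.divergenceOn φ ν X)) μ) ∧
    -- the variational formula
    (∀ μ : X, PhiDiv.divergence φ ν (μ : MeasureTheory.SignedMeasure Ω)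
      = ⨆ g ∈ {g : PhiDiv.MeasFun Ω | PhiDiv.cls X g ∈ Y ∧
            PhiDiv.EssRangeInSlopes φ (PhiDiv.nullIdeal X) (g : Ω → ℝ)},
          ((PhiDiv.integralL0 μ (PhiDiv.cls X g) : ℝ) : EReal)
            - PhiDiv.extIntegral ν (fun ω => PhiDiv.realConjugate φ ((g : Ω → ℝ) ω))) := by
  refine ⟨fun h hY => ⟨fun hS => ?_, fun hS => PhiDiv.conjugate_eq_top hφ hXY hY hS⟩, ?_,
    fun τ hτ => ?_, PhiDiv.divergence_eq_biconjugate hφ hXY, PhiDiv.divergence_eq_iSup hφ hXY⟩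
  · exact (PhiDiv.conjugate_le_extIntegral hφ hXY hY hS).antisymm
      (PhiDiv.extIntegral_le_conjugate hφ hXY hY)
  · refine PhiDiv.lowerSemicontinuous_divergenceOn hφ hXY (PhiDiv.weakTopology X Y) fun h => ?_
    let := PhiDiv.weakTopology X Y
    exact (continuous_apply (A := fun _ : Y => ℝ) h).comp
      (continuous_induced_dom (f := fun (μ : X) (h : Y) => PhiDiv.pairing X Y μ h))
  · exact PhiDiv.lowerSemicontinuous_divergenceOn hφ hXY τ (hτ.continuous_pairing hXY)
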